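/- For a function $f$ analytic at $0$ write $[z^n]f$ for its $n$-th Taylor coefficient at $0$. The Hadamard product of two such functions is $(f\odot g)(z)=\sum_{n\ge 0}([z^n]f)([z^n]g)\,z^n$. For $\eta>0$ and $0<\phi<\pi/2$ let $$\Delta(\phi,\eta)=\{z\in\mathbb C:\ |z|<1+\eta,\ |\operatorname{Arg}(z-1)|>\phi\}$$ (so $1\notin\Delta(\phi,\eta)$). A function defined by a Taylor series with radius of convergence $1$ is called $\Delta$-regular if it can be continued analytically to some $\Delta(\phi,\eta)$. Given complex numbers $c_i$ and pairwise distinct real exponents $\alpha_i$ ($i\in I$, $I$ infinite), only finitely many of which lie below any given real number, we say that $f$ has the infinite $\Delta$-expansion $f(z)\sim\sum_{i\in I}c_i(1-z)^{\alpha_i}$ if $f$ is $\Delta$-regular and there is a domain $\Delta(\phi,\eta)$ to which $f$ continues analytically and in which, for every real $A$, $$f(z)=\sum_{i:\ \alpha_i<A}c_i(1-z)^{\alpha_i}+O(|1-z|^A)\qquad\text{uniformly in } z\in\Delta(\phi,\eta).$$ Powers of $1-z$ are principal branches, and $x^{\overline{k}}=x(x+1)\cdots(x+k-1)$ for integers $k\ge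 0$. **Proposition.** Let $a,b$ be real numbers such that none of $a$, $b$, $a+b$ is an integer. Then for $|z|<1$ $$(1-z)^a\odot(1-z)^b={}_2F_1[-a,-b;1;z]=\sum_{n\ge0}\frac{(-a)^{\overline n}(-b)^{\overline n}}{n!}\,\frac{z^n}{n!}.$$ This function is $\Delta$-regular, and it has an infinite $\Delta$-expansion with exponent scale $\{0,1,2,\ldots\}\cup\{a+b+1,a+b+2,\ldots\}$, namely $$(1-z)^a\odot(1-z)^b\ \sim\ \sum_{k\ge0}\lambda_k^{(a,b)}\frac{(1-z)^k}{k!}+\sum_{k\ge0}\mu_k^{(a,b)}\frac{(1-z)^{a+b+1+k}}{k!},$$ where $$\lambda_k^{(a,b)}=\frac{\Gamma(1+a+b)}{\Gamma(1+a)\Gamma(1+b)}\,\frac{(-a)^{\overline k}(-b)^{\overline k}}{(-a-b)^{\overline k}},\qquad \mu_k^{(a,b)}=\frac{\Gamma(-a-b-1)}{\Gamma(-a)\Gamma(-b)}\,\frac{(1+a)^{\overline k}(1+b)^{\overline k}}{(2+a+b)^{\overline k}}.$$ -/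

import Mathlib

open Asymptotics

noncomputable section

/-- The indented disc `Δ(φ, η) = {z : |z| < 1 + η, |Arg (z - 1)| > φ}`.
For `φ > 0` it does not contain the point `1`, since `Complex.arg 0 = 0`. -/
def deltaDomain (φ η : ℝ) : Set ℂ :=
  {z | ‖z‖ < 1 + η ∧ φ < |Complex.arg (z - 1)|}

/-- `f` is given on the open unit disc by a power series about `0` whose radius of convergence is
exactly `1`. -/
def IsTaylorOfRadiusOne (f : ℂ → ℂ) : Prop :=
  ∃ p : FormalMultilinearSeries ℂ ℂ ℂ, p.radius = 1 ∧ HasFPowerSeriesOnBall f p 0 1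

/-- `F` is an analytic continuation to `Δ(φ, η)` of the restriction of `f` to the unit disc. -/
def IsDeltaContinuation (f : ℂ → ℂ) (φ η : ℝ) (F : ℂ → ℂ) : Prop :=
  DifferentiableOn ℂ F (deltaDomain φ η) ∧ Set.EqOn F f (Metric.ball 0 1)

/-- `f` is `Δ`-regular: it is defined by a Taylor series of radius of convergence `1` and continues
analytically to some `Δ(φ, η)` with `0 < φ < π / 2` and `η > 0`. -/
def IsDeltaRegular (f : ℂ → ℂ) : Prop :=
  IsTaylorOfRadiusOne f ∧
    ∃ φ η : ℝ, 0 < φ ∧ φ < Real.pi / 2 ∧ 0 < η ∧ ∃ F : ℂ → ℂ, IsDeltaContinuation f φ η F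

/-- The finite singular expansion
`F z = ∑ i ∈ s, c i * (1 - z) ^ α i + O(|1 - z| ^ A)`, uniformly for `z` in `Δ(φ, η)`
(principal branches), with `A` larger than all the exponents used. -/
def HasSingularExpansionOn {ι : Type*} (F : ℂ → ℂ) (φ η : ℝ) (s : Finset ι)
    (c : ι → ℂ) (α : ι → ℝ) (A : ℝ) : Prop :=
  (∀ i ∈ s, α i < A) ∧
    (fun z : ℂ => F z - ∑ i ∈ s, c i * (1 - z) ^ (α i : ℂ))
      =O[Filter.principal (deltaDomain φ η)] fun z : ℂ => ‖1 - z‖ ^ A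

/-- The infinite `Δ`-expansion `f z ∼ ∑ i, c i * (1 - z) ^ α i` over a family `α` of pairwise distinct
real exponents: `f` is `Δ`-regular and, in one and the same domain `Δ(φ, η)`, for every real `A`
only finitely many exponents are below `A`, and the terms with these exponents form a singular
expansion with error `O(|1 - z| ^ A)`. -/
def HasInfiniteDeltaExpansion {ι : Type*} (f : ℂ → ℂ) (c : ι → ℂ) (α : ι → ℝ) : Prop :=
  IsTaylorOfRadiusOne f ∧ Infinite ι ∧ Function.Injective α ∧
    ∃ φ η : ℝ, 0 < φ ∧ φ < Real.pi / 2 ∧ 0 < η ∧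
      ∃ F : ℂ → ℂ, IsDeltaContinuation f φ η F ∧
        ∀ A : ℝ, ∃ s : Finset ι, (∀ i, i ∈ s ↔ α i < A) ∧ HasSingularExpansionOn F φ η s c α A

/-- The Taylor coefficient `[z ^ n] f(z)` at the origin. -/
def taylorCoeffZero (f : ℂ → ℂ) (n : ℕ) : ℂ :=
  iteratedDeriv n f 0 / (n.factorial : ℂ)

/-- The Hadamard product of two functions analytic at the origin, as the sum of the termwise product
of their Taylor series (of interest at points where that series converges). -/
def hadamardProduct (f g : ℂ → ℂ) (z : ℂ) : ℂ :=
  ∑' n : ℕ, taylorCoeffZero f n * taylorCoeffZero g n * z ^ n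

/-- The function `z ↦ (1 - z) ^ a` (principal branch). -/
def oneSubPow (a : ℝ) (z : ℂ) : ℂ :=
  (1 - z) ^ (a : ℂ)

/-- The rising factorial `x (x + 1) ⋯ (x + k - 1)`. -/
def rising (x : ℝ) (k : ℕ) : ℝ :=
  ∏ i ∈ Finset.range k, (x + i)

/-- The coefficients of `(1 - z) ^ k / k!`. -/
def lambdaCoeff (a b : ℝ) (k : ℕ) : ℝ :=
  Real.Gamma (1 + a + b) / (Real.Gamma (1 + a) * Real.Gamma (1 + b)) *
    (rising (-a) k * rising (-b) k / rising (-a - b) k)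

/-- The coefficients of `(1 - z) ^ (a + b + 1 + k) / k!`. -/
def muCoeff (a b : ℝ) (k : ℕ) : ℝ :=
  Real.Gamma (-a - b - 1) / (Real.Gamma (-a) * Real.Gamma (-b)) *
    (rising (1 + a) k * rising (1 + b) k / rising (2 + a + b) k)

end

/-! The coefficients of `(1 - z) ^ a` are `(-a)_n / n!`, so the Hadamard product is `₂F₁(-a, -b; 1;
z)` (`hyperZero`). Its expansion at `1` is read off from the connection formula (`connected`), which
writes it as a combination of `₂F₁(-a, -b; -a-b; 1-z)` and `(1-z)^(1+a+b) ₂F₁(1+a, 1+b; 2+a+b;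
1-z)`; up to the Gamma quotients, the Taylor coefficients of these two series are the `λ_k / k!` and
`μ_k / k!`.

The second order equation is replaced by a first order system for the pair `(y, t)` of contiguous
functions with parameters `a` and `a - 1` (`IsContiguousPair`). The normalised determinant of two
solutions is constant (`casoratian_eq`), hence three solutions satisfy a linear relation whose
coefficients are limits of such determinants as `z → 1` (`linear_relation`). For `-1 < b < 0` and
`-1 < a + b < 0` Euler's integral yields these limits: Gauss's theorem for `y`, Euler's
transformation for `t`. Each component of a solution is determined by the other through the system,
so the formulas for `a` and `a - 1` are equivalent; with the symmetry in `a, b`, integer shifts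
reach all admissible parameters (`NonIntegral.induction`).

The same induction continues `hyperZero` to the plane slit along `[1, ∞)` (`hasSlitContinuation`).
Near `1` the identity theorem extends the connection formula and both series are truncated; the rest
of the indented disc lies in a compact part of the slit plane, where the error is bounded. -/

section HypergeometricConnection

/-! ### Coefficients of the hypergeometric series under parameter shifts. -/

open Polynomial in
lemma ascPochhammer_eval_add_one_mul (x : ℂ) (n : ℕ) :
    x * (ascPochhammer ℂ n).eval (x + 1) = (ascPochhammer ℂ n).eval x * (x + n) := by
  have h1 := ascPochhammer_succ_eval n x
  rw [ascPochhammer_succ_left] at h1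
  simpa [eval_mul, eval_comp] using h1

lemma ascPochhammer_eval_ne_zero {x : ℂ} (hx : ∀ n : ℕ, x + n ≠ 0) (n : ℕ) :
    (ascPochhammer ℂ n).eval x ≠ 0 := by
  rw [Ne, ascPochhammer_eval_eq_zero_iff]
  rintro ⟨k, -, hk⟩
  exact hx k (by rw [hk]; ring)

lemma hasSum_congr_fun {f g : ℕ → ℂ} {a : ℂ} (h : ∀ n, f n = g n) : HasSum f a ↔ HasSum g a := by
  rw [funext h]

/-- The coefficients of the hypergeometric series. -/
noncomputable def hypergeometricCoeff (α β γ : ℂ) (n : ℕ) : ℂ :=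
  ordinaryHypergeometricCoefficient α β γ n

lemma hypergeometricCoeff_zero (α β γ : ℂ) :
    hypergeometricCoeff α β γ 0 = 1 := by
  simp [hypergeometricCoeff, ordinaryHypergeometricCoefficient]

lemma hypergeometricCoeff_succ {α β γ : ℂ} (hγ : ∀ n : ℕ, γ + n ≠ 0) (n : ℕ) :
    hypergeometricCoeff α β γ (n + 1) * ((n + 1) * (γ + n)) =
      hypergeometricCoeff α β γ n * ((α + n) * (β + n)) := by
  have h1 := ascPochhammer_eval_ne_zero hγ n
  have h2 := hγ n
  have h3 : (n.factorial : ℂ) ≠ 0 := by exact_mod_cast n.factorial_ne_zero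
  have h4 : (n + 1 : ℂ) ≠ 0 := by exact_mod_cast n.succ_ne_zero
  simp only [hypergeometricCoeff, ordinaryHypergeometricCoefficient, ascPochhammer_succ_eval,
    Nat.factorial_succ, Nat.cast_mul, Nat.cast_add, Nat.cast_one]
  field_simp

lemma hypergeometricCoeff_add_one_left {α β γ : ℂ} (n : ℕ) :
    α * hypergeometricCoeff (α + 1) β γ n =
      hypergeometricCoeff α β γ n * (α + n) := by
  have h := ascPochhammer_eval_add_one_mul α n
  simp only [hypergeometricCoeff, ordinaryHypergeometricCoefficient]
  linear_combination ((n.factorial : ℂ)⁻¹ * (ascPochhammer ℂ n).eval β *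
    ((ascPochhammer ℂ n).eval γ)⁻¹) * h

lemma hypergeometricCoeff_symm (α β γ : ℂ) (n : ℕ) :
    hypergeometricCoeff α β γ n = hypergeometricCoeff β α γ n := by
  simp only [hypergeometricCoeff, ordinaryHypergeometricCoefficient]
  ring

lemma hypergeometricCoeff_add_one_right {α β γ : ℂ} (hγ : ∀ n : ℕ, γ + n ≠ 0)
    (n : ℕ) :
    (γ + n) * hypergeometricCoeff α β (γ + 1) n =
      γ * hypergeometricCoeff α β γ n := by
  have h := ascPochhammer_eval_add_one_mul γ n
  have h1 := ascPochhammer_eval_ne_zero hγ n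
  have h0 := hγ n
  have h2 := hγ 0
  simp only [Nat.cast_zero, add_zero] at h2
  have h3 : (ascPochhammer ℂ n).eval (γ + 1) ≠ 0 := fun h3 => by
    rw [h3, mul_zero] at h
    exact mul_ne_zero h1 h0 h.symm
  simp only [hypergeometricCoeff, ordinaryHypergeometricCoefficient]
  have e : (γ + n) * ((ascPochhammer ℂ n).eval (γ + 1))⁻¹ = γ * ((ascPochhammer ℂ n).eval γ)⁻¹ := by
    field_simp
    linear_combination -h
  linear_combination ((n.factorial : ℂ)⁻¹ * (ascPochhammer ℂ n).eval α *
    (ascPochhammer ℂ n).eval β) * e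

lemma hypergeometricCoeff_succ_eq_add_one {α β γ : ℂ} (hγ : ∀ n : ℕ, γ + n ≠ 0)
    (n : ℕ) :
    (n + 1) * hypergeometricCoeff α β γ (n + 1) =
      α * β / γ * hypergeometricCoeff (α + 1) (β + 1) (γ + 1) n := by
  have h0 := hγ n
  have h2 := hγ 0
  simp only [Nat.cast_zero, add_zero] at h2
  have e1 := hypergeometricCoeff_succ (α := α) (β := β) hγ n
  have e2 := hypergeometricCoeff_add_one_right (α := α + 1) (β := β + 1) hγ n
  have e3 := hypergeometricCoeff_add_one_left (α := α) (β := β) (γ := γ) n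
  have e4 := hypergeometricCoeff_add_one_left (α := β) (β := α + 1) (γ := γ) n
  rw [hypergeometricCoeff_symm (β + 1),
    hypergeometricCoeff_symm β] at e4
  apply mul_right_cancel₀ h0
  rw [div_mul_eq_mul_div, div_mul_eq_mul_div, eq_div_iff h2]
  linear_combination γ * e1 - α * β * e2 - γ * α * e4 - γ * (β + n) * e3

/-! ### The hypergeometric series as an analytic function on the unit disc. -/

lemma ordinaryHypergeometric_radius {α β γ : ℂ} (hα : ∀ n : ℕ, α + n ≠ 0)
    (hβ : ∀ n : ℕ, β + n ≠ 0) (hγ : ∀ n : ℕ, γ + n ≠ 0) :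
    (ordinaryHypergeometricSeries ℂ α β γ).radius = 1 :=
  ordinaryHypergeometricSeries_radius_eq_one ℂ α β γ fun n =>
    ⟨fun h => hα n (by rw [h]; ring), fun h => hβ n (by rw [h]; ring),
      fun h => hγ n (by rw [h]; ring)⟩

lemma ordinaryHypergeometric_hasFPowerSeriesOnBall {α β γ : ℂ} (hα : ∀ n : ℕ, α + n ≠ 0)
    (hβ : ∀ n : ℕ, β + n ≠ 0) (hγ : ∀ n : ℕ, γ + n ≠ 0) :
    HasFPowerSeriesOnBall (ordinaryHypergeometric α β γ : ℂ → ℂ)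
      (ordinaryHypergeometricSeries ℂ α β γ) 0 1 := by
  have h := ordinaryHypergeometric_radius hα hβ hγ
  rw [← h]
  exact FormalMultilinearSeries.hasFPowerSeriesOnBall _ (by rw [h]; exact one_pos)

lemma ordinaryHypergeometric_hasSum {α β γ : ℂ} (hα : ∀ n : ℕ, α + n ≠ 0)
    (hβ : ∀ n : ℕ, β + n ≠ 0) (hγ : ∀ n : ℕ, γ + n ≠ 0) {z : ℂ} (hz : ‖z‖ < 1) :
    HasSum (fun n => hypergeometricCoeff α β γ n * z ^ n)
      (ordinaryHypergeometric α β γ z) := by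
  have h := (ordinaryHypergeometric_hasFPowerSeriesOnBall hα hβ hγ).hasSum (y := z)
    (by rw [← ENNReal.ofReal_one, Metric.eball_ofReal]; simpa using hz)
  simpa [ordinaryHypergeometricSeries, FormalMultilinearSeries.ofScalars_apply_eq,
    hypergeometricCoeff, mul_comm] using h

lemma ordinaryHypergeometric_summable_norm {α β γ : ℂ} (hα : ∀ n : ℕ, α + n ≠ 0)
    (hβ : ∀ n : ℕ, β + n ≠ 0) (hγ : ∀ n : ℕ, γ + n ≠ 0) {r : ℝ} (hr : 0 ≤ r) (hr1 : r < 1) :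
    Summable fun n => ‖hypergeometricCoeff α β γ n‖ * r ^ n := by
  have h := (ordinaryHypergeometric_hasSum hα hβ hγ (z := r)
    (by simpa [abs_of_nonneg hr] using hr1)).summable.norm
  simpa [abs_of_nonneg hr] using h

lemma ordinaryHypergeometric_differentiableAt {α β γ : ℂ} (hα : ∀ n : ℕ, α + n ≠ 0)
    (hβ : ∀ n : ℕ, β + n ≠ 0) (hγ : ∀ n : ℕ, γ + n ≠ 0) {z : ℂ} (hz : ‖z‖ < 1) :
    DifferentiableAt ℂ (ordinaryHypergeometric α β γ : ℂ → ℂ) z :=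
  ((ordinaryHypergeometric_hasFPowerSeriesOnBall hα hβ hγ).analyticAt_of_mem
    (by rw [← ENNReal.ofReal_one, Metric.eball_ofReal]; simpa using hz)).differentiableAt

lemma add_one_add_natCast_ne_zero {x : ℂ} (hx : ∀ n : ℕ, x + n ≠ 0) (n : ℕ) : x + 1 + n ≠ 0 := by
  have := hx (n + 1)
  push_cast at this
  rwa [add_assoc, add_comm (1 : ℂ)]

lemma ordinaryHypergeometric_hasDerivAt {α β γ : ℂ} (hα : ∀ n : ℕ, α + n ≠ 0)
    (hβ : ∀ n : ℕ, β + n ≠ 0) (hγ : ∀ n : ℕ, γ + n ≠ 0) {z : ℂ} (hz : ‖z‖ < 1) :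
    HasDerivAt (ordinaryHypergeometric α β γ : ℂ → ℂ)
      (α * β / γ * ordinaryHypergeometric (α + 1) (β + 1) (γ + 1) z) z := by
  obtain ⟨r, hzr, hr1⟩ := exists_between hz
  have hr : 0 < r := (norm_nonneg z).trans_lt hzr
  set h := hypergeometricCoeff α β γ with hh
  have hα' := add_one_add_natCast_ne_zero hα
  have hβ' := add_one_add_natCast_ne_zero hβ
  have hγ' := add_one_add_natCast_ne_zero hγ
  have key : HasDerivAt (fun w => ∑' n, h n * w ^ n) (∑' n, h n * (n * z ^ (n - 1))) z := by
    refine hasDerivAt_tsum_of_isPreconnected (𝕜 := ℂ) (F := ℂ) (g := fun n w => h n * w ^ n)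
      (g' := fun n w => h n * (n * w ^ (n - 1))) (u := fun n => ‖h n‖ * (n * r ^ (n - 1)))
      (t := Metric.ball 0 r) (y₀ := 0) ?_ Metric.isOpen_ball
      (convex_ball (0 : ℂ) r).isPreconnected ?_ ?_ (Metric.mem_ball_self hr) ?_ (by simpa using hzr)
    -- After an index shift the derivative terms are a constant multiple of the series with all
    -- parameters raised by one, which converges absolutely at `r < 1`.
    · rw [← summable_nat_add_iff 1]
      have := (ordinaryHypergeometric_summable_norm hα' hβ' hγ' hr.le hr1).mul_left ‖α * β / γ‖
      refine this.congr fun n => ?_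
      have e := congrArg norm (hypergeometricCoeff_succ_eq_add_one
        (α := α) (β := β) hγ n)
      rw [norm_mul, norm_mul, show (n + 1 : ℂ) = ((n + 1 : ℕ) : ℂ) by push_cast; rfl,
        Complex.norm_natCast] at e
      rw [Nat.add_sub_cancel, ← mul_assoc, ← mul_assoc, ← e, hh]
      ring
    · intro n y _
      exact (hasDerivAt_pow n y).const_mul (h n)
    · intro n y hy
      rw [norm_mul, norm_mul, norm_pow, Complex.norm_natCast]
      have : ‖y‖ ≤ r := by simpa using (Metric.mem_ball.1 hy).le
      gcongr
    · exact (ordinaryHypergeometric_hasSum hα hβ hγ (by simp)).summable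
  have e1 : (∑' n, h n * (n * z ^ (n - 1))) =
      α * β / γ * ordinaryHypergeometric (α + 1) (β + 1) (γ + 1) z := by
    refine HasSum.tsum_eq ?_
    rw [← hasSum_nat_add_iff' 1]
    have := (ordinaryHypergeometric_hasSum hα' hβ' hγ' hz).mul_left (α * β / γ)
    simp only [Finset.range_one, Finset.sum_singleton, Nat.cast_zero, zero_mul, mul_zero, sub_zero]
    refine (hasSum_congr_fun fun n => ?_).1 this
    rw [← mul_assoc, ← hypergeometricCoeff_succ_eq_add_one hγ n, hh]
    push_cast [Nat.add_sub_cancel]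
    ring
  rw [e1] at key
  refine key.congr_of_eventuallyEq ?_
  filter_upwards [Metric.isOpen_ball.mem_nhds (show z ∈ Metric.ball (0 : ℂ) 1 by simpa using hz)]
    with w hw
  exact (ordinaryHypergeometric_hasSum hα hβ hγ (by simpa using hw)).tsum_eq.symm

lemma ordinaryHypergeometric_hasSum_deriv {α β γ : ℂ} (hα : ∀ n : ℕ, α + n ≠ 0)
    (hβ : ∀ n : ℕ, β + n ≠ 0) (hγ : ∀ n : ℕ, γ + n ≠ 0) {z : ℂ} (hz : ‖z‖ < 1) :
    HasSum (fun n : ℕ => (n + 1) * hypergeometricCoeff α β γ (n + 1) * z ^ n)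
      (deriv (ordinaryHypergeometric α β γ : ℂ → ℂ) z) := by
  rw [(ordinaryHypergeometric_hasDerivAt hα hβ hγ hz).deriv]
  have := (ordinaryHypergeometric_hasSum (add_one_add_natCast_ne_zero hα)
    (add_one_add_natCast_ne_zero hβ) (add_one_add_natCast_ne_zero hγ) hz).mul_left (α * β / γ)
  refine (hasSum_congr_fun fun n => ?_).1 this
  rw [hypergeometricCoeff_succ_eq_add_one hγ, mul_assoc]

lemma ordinaryHypergeometric_hasSum_mul_deriv {α β γ : ℂ} (hα : ∀ n : ℕ, α + n ≠ 0)
    (hβ : ∀ n : ℕ, β + n ≠ 0) (hγ : ∀ n : ℕ, γ + n ≠ 0) {z : ℂ} (hz : ‖z‖ < 1) :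
    HasSum (fun n : ℕ => n * hypergeometricCoeff α β γ n * z ^ n)
      (z * deriv (ordinaryHypergeometric α β γ : ℂ → ℂ) z) := by
  rw [← hasSum_nat_add_iff' 1]
  have := (ordinaryHypergeometric_hasSum_deriv hα hβ hγ hz).mul_left z
  simp only [Finset.range_one, Finset.sum_singleton, Nat.cast_zero, zero_mul, sub_zero]
  refine (hasSum_congr_fun fun n => ?_).1 this
  push_cast
  ring

/-! ### Contiguity relations, proved by comparing coefficients. -/

/-- Contiguity relation raising the first and the third parameter. -/
lemma ordinaryHypergeometric_raise_left_right {α β γ : ℂ} (hα : ∀ n : ℕ, α + n ≠ 0)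
    (hβ : ∀ n : ℕ, β + n ≠ 0) (hγ : ∀ n : ℕ, γ + n ≠ 0) {z : ℂ} (hz : ‖z‖ < 1) :
    (1 - z) * deriv (ordinaryHypergeometric α β γ : ℂ → ℂ) z - α * ordinaryHypergeometric α β γ z =
      α * (β - γ) / γ * ordinaryHypergeometric (α + 1) β (γ + 1) z := by
  have h1 := ordinaryHypergeometric_hasSum_deriv hα hβ hγ hz
  have h2 := ordinaryHypergeometric_hasSum_mul_deriv hα hβ hγ hz
  have h3 := (ordinaryHypergeometric_hasSum hα hβ hγ hz).mul_left α
  have h4 := (ordinaryHypergeometric_hasSum (add_one_add_natCast_ne_zero hα) hβ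
    (add_one_add_natCast_ne_zero hγ) hz).mul_left (α * (β - γ) / γ)
  rw [sub_mul, one_mul]
  refine ((h1.sub h2).sub h3).unique ((hasSum_congr_fun fun n => ?_).1 h4)
  have e1 := hypergeometricCoeff_succ (α := α) (β := β) hγ n
  have e2 := hypergeometricCoeff_add_one_right (α := α + 1) (β := β) hγ n
  have e3 := hypergeometricCoeff_add_one_left (α := α) (β := β) (γ := γ) n
  have g0 : γ ≠ 0 := by simpa using hγ 0
  have e : α * (β - γ) / γ * hypergeometricCoeff (α + 1) β (γ + 1) n =
      (n + 1) * hypergeometricCoeff α β γ (n + 1) - n * hypergeometricCoeff α β γ n -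
        α * hypergeometricCoeff α β γ n := by
    apply mul_right_cancel₀ (hγ n)
    rw [div_mul_eq_mul_div, div_mul_eq_mul_div, div_eq_iff g0]
    linear_combination α * (β - γ) * e2 + γ * (β - γ) * e3 - γ * e1
  linear_combination z ^ n * e

/-- Contiguity relation lowering the first and the third parameter. -/
lemma ordinaryHypergeometric_lower_left_right {α β γ : ℂ} (hα : ∀ n : ℕ, α + n ≠ 0)
    (hβ : ∀ n : ℕ, β + n ≠ 0) (hγ : ∀ n : ℕ, γ + n ≠ 0) {z : ℂ} (hz : ‖z‖ < 1) :
    z * (1 - z) * deriv (ordinaryHypergeometric (α + 1) β (γ + 1) : ℂ → ℂ) z +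
        (γ - β * z) * ordinaryHypergeometric (α + 1) β (γ + 1) z =
      γ * ordinaryHypergeometric α β γ z := by
  have hα' := add_one_add_natCast_ne_zero hα
  have hγ' := add_one_add_natCast_ne_zero hγ
  -- Removing the constant terms leaves series in `z ^ (n + 1)`, aligned index by index with the
  -- series `h3`, `h4` multiplied by `z`.
  have h1 := ((hasSum_nat_add_iff' 1).2 (ordinaryHypergeometric_hasSum_mul_deriv hα' hβ hγ' hz))
  have h2 := ((hasSum_nat_add_iff' 1).2 (ordinaryHypergeometric_hasSum hα' hβ hγ' hz)).mul_left γ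
  have h3 := (ordinaryHypergeometric_hasSum_mul_deriv hα' hβ hγ' hz).mul_left z
  have h4 := (ordinaryHypergeometric_hasSum hα' hβ hγ' hz).mul_left (β * z)
  have h5 := ((hasSum_nat_add_iff' 1).2 (ordinaryHypergeometric_hasSum hα hβ hγ hz)).mul_left γ
  have key := ((h1.add h2).sub (h3.add h4)).unique ((hasSum_congr_fun fun n => ?_).1 h5)
  · simp only [Finset.range_one, Finset.sum_singleton, Nat.cast_zero, pow_zero, mul_one,
      hypergeometricCoeff_zero] at key
    linear_combination key
  · have e1 := hypergeometricCoeff_succ (α := α + 1) (β := β) hγ' n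
    have e2 := hypergeometricCoeff_add_one_right (α := α + 1) (β := β) hγ (n + 1)
    have e3 := hypergeometricCoeff_add_one_left (α := α) (β := β) (γ := γ) (n + 1)
    have g1 := hα' n
    have e : γ * hypergeometricCoeff α β γ (n + 1) =
        (n + 1 + γ) * hypergeometricCoeff (α + 1) β (γ + 1) (n + 1) -
          (n + β) * hypergeometricCoeff (α + 1) β (γ + 1) n := by
      apply mul_right_cancel₀ g1
      push_cast at e2 e3
      linear_combination -e1 - γ * e3 - α * e2
    push_cast
    linear_combination z ^ (n + 1) * e

/-- Contiguity relation raising the first parameter. -/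
lemma ordinaryHypergeometric_raise_left {α β γ : ℂ} (hα : ∀ n : ℕ, α + n ≠ 0)
    (hβ : ∀ n : ℕ, β + n ≠ 0) (hγ : ∀ n : ℕ, γ + n ≠ 0) {z : ℂ} (hz : ‖z‖ < 1) :
    z * deriv (ordinaryHypergeometric α β γ : ℂ → ℂ) z + α * ordinaryHypergeometric α β γ z =
      α * ordinaryHypergeometric (α + 1) β γ z := by
  have h2 := ordinaryHypergeometric_hasSum_mul_deriv hα hβ hγ hz
  have h3 := (ordinaryHypergeometric_hasSum hα hβ hγ hz).mul_left α
  have h4 := (ordinaryHypergeometric_hasSum (add_one_add_natCast_ne_zero hα) hβ hγ hz).mul_left α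
  refine (h2.add h3).unique ((hasSum_congr_fun fun n => ?_).1 h4)
  have e3 := hypergeometricCoeff_add_one_left (α := α) (β := β) (γ := γ) n
  linear_combination z ^ n * e3

/-- Contiguity relation lowering the first parameter. -/
lemma ordinaryHypergeometric_lower_left {α β γ : ℂ} (hα : ∀ n : ℕ, α + n ≠ 0)
    (hβ : ∀ n : ℕ, β + n ≠ 0) (hγ : ∀ n : ℕ, γ + n ≠ 0) {z : ℂ} (hz : ‖z‖ < 1) :
    z * (1 - z) * deriv (ordinaryHypergeometric (α + 1) β γ : ℂ → ℂ) z +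
        (γ - (α + 1) - β * z) * ordinaryHypergeometric (α + 1) β γ z =
      (γ - (α + 1)) * ordinaryHypergeometric α β γ z := by
  have hα' := add_one_add_natCast_ne_zero hα
  have h1 := ((hasSum_nat_add_iff' 1).2 (ordinaryHypergeometric_hasSum_mul_deriv hα' hβ hγ hz))
  have h2 := ((hasSum_nat_add_iff' 1).2 (ordinaryHypergeometric_hasSum hα' hβ hγ hz)).mul_left
    (γ - (α + 1))
  have h3 := (ordinaryHypergeometric_hasSum_mul_deriv hα' hβ hγ hz).mul_left z
  have h4 := (ordinaryHypergeometric_hasSum hα' hβ hγ hz).mul_left (β * z)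
  have h5 := ((hasSum_nat_add_iff' 1).2 (ordinaryHypergeometric_hasSum hα hβ hγ hz)).mul_left
    (γ - (α + 1))
  have key := ((h1.add h2).sub (h3.add h4)).unique ((hasSum_congr_fun fun n => ?_).1 h5)
  · simp only [Finset.range_one, Finset.sum_singleton, Nat.cast_zero, pow_zero, mul_one,
      hypergeometricCoeff_zero] at key
    linear_combination key
  · have e1 := hypergeometricCoeff_succ (α := α + 1) (β := β) hγ n
    have e3 := hypergeometricCoeff_add_one_left (α := α) (β := β) (γ := γ) (n + 1)
    have g1 := hα' n
    have e : (γ - (α + 1)) * hypergeometricCoeff α β γ (n + 1) =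
        (n + 1 + (γ - (α + 1))) * hypergeometricCoeff (α + 1) β γ (n + 1) -
          (n + β) * hypergeometricCoeff (α + 1) β γ n := by
      apply mul_right_cancel₀ g1
      push_cast at e3
      linear_combination -e1 - (γ - (α + 1)) * e3
    push_cast
    linear_combination z ^ (n + 1) * e

lemma ordinaryHypergeometric_symm (α β γ : ℂ) :
    (ordinaryHypergeometric α β γ : ℂ → ℂ) = ordinaryHypergeometric β α γ := by
  funext z
  rw [ordinaryHypergeometric, ordinaryHypergeometric, ordinaryHypergeometricSeries_symm]

/-! ### Admissible parameters. -/

/-- None of `a`, `b`, `a + b` is an integer. -/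
structure NonIntegral (a b : ℂ) : Prop where
  left : ∀ m : ℤ, a ≠ m
  right : ∀ m : ℤ, b ≠ m
  add : ∀ m : ℤ, a + b ≠ m

namespace NonIntegral

variable {a b : ℂ}

lemma symm (h : NonIntegral a b) : NonIntegral b a :=
  ⟨h.right, h.left, fun m => by rw [add_comm]; exact h.add m⟩

lemma shift (h : NonIntegral a b) (k : ℤ) : NonIntegral (a + k) b := by
  refine ⟨fun m hm => h.left (m - k) ?_, h.right, fun m hm => h.add (m - k) ?_⟩
  · push_cast; linear_combination hm
  · push_cast; linear_combination hm

lemma sub_one (h : NonIntegral a b) : NonIntegral (a - 1) b := by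
  simpa [sub_eq_add_neg] using h.shift (-1)

lemma left_ne (h : NonIntegral a b) (k : ℤ) : a + k ≠ 0 := fun e =>
  h.left (-k) (by push_cast; linear_combination e)

lemma neg_left_ne (h : NonIntegral a b) (k : ℤ) : -a + k ≠ 0 := fun e =>
  h.left k (by linear_combination -e)

lemma add_ne (h : NonIntegral a b) (k : ℤ) : a + b + k ≠ 0 := fun e =>
  h.add (-k) (by push_cast; linear_combination e)

lemma neg_add_ne (h : NonIntegral a b) (k : ℤ) : -a - b + k ≠ 0 := fun e =>
  h.add k (by linear_combination -e)

lemma one_add_left (h : NonIntegral a b) (n : ℕ) : 1 + a + n ≠ 0 := by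
  have := h.left_ne (1 + n)
  push_cast at this
  rwa [add_comm 1 a, add_assoc]

lemma neg_left (h : NonIntegral a b) (n : ℕ) : -a + n ≠ 0 := by
  simpa using h.neg_left_ne n

lemma neg_add (h : NonIntegral a b) (n : ℕ) : -a - b + n ≠ 0 := by
  simpa using h.neg_add_ne n

lemma two_add_add (h : NonIntegral a b) (n : ℕ) : 2 + a + b + n ≠ 0 := by
  have := h.add_ne (2 + n)
  push_cast at this
  rwa [show 2 + a + b + (n : ℂ) = a + b + (2 + n) by ring]

lemma left_ne_zero (h : NonIntegral a b) : a ≠ 0 := by simpa using h.left_ne 0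

lemma add_ne_zero (h : NonIntegral a b) : a + b ≠ 0 := by simpa using h.add_ne 0

lemma one_add_add_ne_zero (h : NonIntegral a b) : 1 + a + b ≠ 0 := by
  have := h.add_ne 1
  push_cast at this
  rwa [show 1 + a + b = a + b + 1 by ring]

end NonIntegral

lemma one_add_natCast_ne_zero (n : ℕ) : (1 : ℂ) + n ≠ 0 := by
  rw [add_comm]
  exact_mod_cast n.succ_ne_zero

/-! ### The three local solutions and their ladder relations in `a`. -/

/-- `₂F₁(-a, -b; 1; z)`, the Hadamard product of `(1 - z) ^ a` and `(1 - z) ^ b`. -/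
noncomputable def hyperZero (a b z : ℂ) : ℂ := ordinaryHypergeometric (-a) (-b) 1 z

/-- The solution at `1` of the hypergeometric equation of `hyperZero` which is analytic there, as a
function of `w = 1 - z`. -/
noncomputable def hyperOne (a b w : ℂ) : ℂ := ordinaryHypergeometric (-a) (-b) (-a - b) w

/-- The analytic factor in the solution at `1` of the hypergeometric equation of `hyperZero` with
exponent `1 + a + b`, as a function of `w = 1 - z`. -/
noncomputable def hyperPow (a b w : ℂ) : ℂ := ordinaryHypergeometric (1 + a) (1 + b) (2 + a + b) w

variable {a b : ℂ}

lemma hyperZero_symm (a b : ℂ) : hyperZero a b = hyperZero b a :=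
  ordinaryHypergeometric_symm _ _ _

lemma hyperOne_symm (a b : ℂ) : hyperOne a b = hyperOne b a := by
  funext w
  rw [hyperOne, hyperOne, ordinaryHypergeometric_symm, show -a - b = -b - a by ring]

lemma hyperPow_symm (a b : ℂ) : hyperPow a b = hyperPow b a := by
  funext w
  rw [hyperPow, hyperPow, ordinaryHypergeometric_symm, show 2 + a + b = 2 + b + a by ring]

lemma hyperZero_differentiableAt (h : NonIntegral a b) {z : ℂ} (hz : ‖z‖ < 1) :
    DifferentiableAt ℂ (hyperZero a b) z :=
  ordinaryHypergeometric_differentiableAt h.neg_left h.symm.neg_left one_add_natCast_ne_zero hz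

lemma hyperOne_differentiableAt (h : NonIntegral a b) {z : ℂ} (hz : ‖z‖ < 1) :
    DifferentiableAt ℂ (hyperOne a b) z :=
  ordinaryHypergeometric_differentiableAt h.neg_left h.symm.neg_left h.neg_add hz

lemma hyperPow_differentiableAt (h : NonIntegral a b) {z : ℂ} (hz : ‖z‖ < 1) :
    DifferentiableAt ℂ (hyperPow a b) z :=
  ordinaryHypergeometric_differentiableAt h.one_add_left h.symm.one_add_left h.two_add_add hz

/-- The hypergeometric parameter is `-a`, so the relation that raises it lowers `a`. -/
lemma hyperZero_lower (h : NonIntegral a b) {z : ℂ} (hz : ‖z‖ < 1) :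
    z * deriv (hyperZero a b) z = a * (hyperZero a b z - hyperZero (a - 1) b z) := by
  have := ordinaryHypergeometric_raise_left h.neg_left h.symm.neg_left one_add_natCast_ne_zero hz
  simp only [hyperZero, neg_sub]
  rw [show -a + 1 = 1 - a by ring] at this
  change z * deriv (ordinaryHypergeometric (-a) (-b) 1) z = _
  linear_combination this

lemma hyperZero_raise (h : NonIntegral a b) {z : ℂ} (hz : ‖z‖ < 1) :
    z * (1 - z) * deriv (hyperZero (a - 1) b) z + (a + b * z) * hyperZero (a - 1) b z =
      a * hyperZero a b z := by
  have := ordinaryHypergeometric_lower_left h.neg_left h.symm.neg_left one_add_natCast_ne_zero hz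
  have e : hyperZero (a - 1) b = ordinaryHypergeometric (-a + 1) (-b) 1 := by
    funext z; rw [hyperZero, show -(a - 1) = -a + 1 by ring]
  rw [e, hyperZero]
  linear_combination this

/-- Here the third parameter `-a - b` moves together with the first, so the relations shifting both
are the ones needed. -/
lemma hyperOne_lower (h : NonIntegral a b) {w : ℂ} (hw : ‖w‖ < 1) :
    (1 - w) * deriv (hyperOne a b) w =
      a * (a / (a + b) * hyperOne (a - 1) b w - hyperOne a b w) := by
  have := ordinaryHypergeometric_raise_left_right h.neg_left h.symm.neg_left h.neg_add hw
  have e : hyperOne (a - 1) b = ordinaryHypergeometric (-a + 1) (-b) (-a - b + 1) := by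
    funext z; rw [hyperOne, show -(a - 1) = -a + 1 by ring, show -a + 1 - b = -a - b + 1 by ring]
  rw [e, hyperOne]
  have h1 := h.add_ne_zero
  have h2 : -a - b ≠ 0 := by simpa using h.neg_add 0
  have e2 : -a * (-b - (-a - b)) / (-a - b) = a * (a / (a + b)) := by
    field_simp
    ring
  rw [e2] at this
  change (1 - w) * deriv (ordinaryHypergeometric (-a) (-b) (-a - b)) w = _
  linear_combination this

lemma hyperOne_raise (h : NonIntegral a b) {w : ℂ} (hw : ‖w‖ < 1) :
    w * (1 - w) * deriv (hyperOne (a - 1) b) w - (a + b - b * w) * hyperOne (a - 1) b w =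
      -(a + b) * hyperOne a b w := by
  have := ordinaryHypergeometric_lower_left_right h.neg_left h.symm.neg_left h.neg_add hw
  have e : hyperOne (a - 1) b = ordinaryHypergeometric (-a + 1) (-b) (-a - b + 1) := by
    funext z; rw [hyperOne, show -(a - 1) = -a + 1 by ring, show -a + 1 - b = -a - b + 1 by ring]
  rw [e, hyperOne]
  linear_combination this

lemma hyperPow_lower (h : NonIntegral a b) {w : ℂ} (hw : ‖w‖ < 1) :
    w * (1 - w) * deriv (hyperPow a b) w + (1 + a + b - (1 + b) * w) * hyperPow a b w =
      (1 + a + b) * hyperPow (a - 1) b w := by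
  have h1 := h.sub_one.one_add_left
  have h2 := h.sub_one.two_add_add
  rw [show 1 + (a - 1) = a by ring] at h1
  rw [show 2 + (a - 1) + b = 1 + a + b by ring] at h2
  have := ordinaryHypergeometric_lower_left_right h1 h.symm.one_add_left h2 hw
  have e : hyperPow a b = ordinaryHypergeometric (a + 1) (1 + b) (1 + a + b + 1) := by
    funext z; rw [hyperPow, show a + 1 = 1 + a by ring, show 2 + a + b = 1 + a + b + 1 by ring]
  rw [e, hyperPow, show 1 + (a - 1) = a by ring, show 2 + (a - 1) + b = 1 + a + b by ring]
  exact this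

lemma hyperPow_raise (h : NonIntegral a b) {w : ℂ} (hw : ‖w‖ < 1) :
    (1 - w) * deriv (hyperPow (a - 1) b) w - a * hyperPow (a - 1) b w =
      -(a ^ 2 / (1 + a + b)) * hyperPow a b w := by
  have h1 := h.sub_one.one_add_left
  have h2 := h.sub_one.two_add_add
  rw [show 1 + (a - 1) = a by ring] at h1
  rw [show 2 + (a - 1) + b = 1 + a + b by ring] at h2
  have := ordinaryHypergeometric_raise_left_right h1 h.symm.one_add_left h2 hw
  have e : hyperPow (a - 1) b = ordinaryHypergeometric a (1 + b) (1 + a + b) := by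
    funext z
    rw [hyperPow, show 1 + (a - 1) = a by ring, show 2 + (a - 1) + b = 1 + a + b by ring]
  rw [e, hyperPow, show 1 + a = a + 1 by ring, show 2 + a + b = a + 1 + b + 1 by ring,
    show a + 1 + b = 1 + a + b by ring, this]
  ring

/-! ### The contiguous system on the lens and its Casoratian. -/

/-- The intersection of the unit discs about `0` and `1`. -/
def lens : Set ℂ := {z | ‖z‖ < 1 ∧ ‖1 - z‖ < 1}

lemma isOpen_lens : IsOpen lens :=
  (isOpen_lt continuous_norm continuous_const).inter
    (isOpen_lt (continuous_const.sub continuous_id).norm continuous_const)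

lemma convex_lens : Convex ℝ lens := by
  have : lens = Metric.ball 0 1 ∩ Metric.ball 1 1 := by
    ext z; simp [lens, dist_eq_norm, norm_sub_rev]
  rw [this]
  exact (convex_ball _ _).inter (convex_ball _ _)

lemma ne_zero_of_mem_lens {z : ℂ} (hz : z ∈ lens) : z ≠ 0 := by
  rintro rfl
  simpa using hz.2

lemma one_sub_mem_slitPlane {z : ℂ} (hz : ‖z‖ < 1) : 1 - z ∈ Complex.slitPlane := by
  rw [sub_eq_add_neg]
  exact Complex.mem_slitPlane_of_norm_lt_one (by simpa using hz)

/-- `y`, `t` form a solution on the lens of the first order system satisfied by the pair of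
contiguous functions `hyperZero a b`, `hyperZero (a - 1) b`. -/
def IsContiguousPair (a b : ℂ) (y t : ℂ → ℂ) : Prop :=
  ∀ z ∈ lens, ∃ y' t', HasDerivAt y y' z ∧ HasDerivAt t t' z ∧ z * y' = a * (y z - t z) ∧
    z * (1 - z) * t' + (a + b * z) * t z = a * y z

lemma isContiguousPair_hyperZero (h : NonIntegral a b) :
    IsContiguousPair a b (hyperZero a b) (hyperZero (a - 1) b) := fun _ hz =>
  ⟨_, _, (hyperZero_differentiableAt h hz.1).hasDerivAt,
    (hyperZero_differentiableAt h.sub_one hz.1).hasDerivAt, hyperZero_lower h hz.1,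
    hyperZero_raise h hz.1⟩

/-- The factor `a / (a + b)` is the one produced by `hyperOne_lower`; it makes this pair solve the
same system as `hyperZero`. -/
lemma isContiguousPair_hyperOne (h : NonIntegral a b) :
    IsContiguousPair a b (fun z => hyperOne a b (1 - z))
      (fun z => a / (a + b) * hyperOne (a - 1) b (1 - z)) := by
  intro z hz
  have h1 := hyperOne_lower h hz.2
  have h2 := hyperOne_raise h hz.2
  have d1 := (hyperOne_differentiableAt h hz.2).hasDerivAt.comp_const_sub 1 z
  have d2 := ((hyperOne_differentiableAt h.sub_one hz.2).hasDerivAt.comp_const_sub 1 z).const_mul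
    (a / (a + b))
  refine ⟨_, _, d1, d2, ?_, ?_⟩
  · linear_combination -h1
  · have := h.add_ne_zero
    field_simp
    linear_combination -a * h2

/-- Differentiating the power lowers its exponent to `a + b` and brings out `1 + a + b`, whence the
normalisation of the second component. -/
lemma isContiguousPair_hyperPow (h : NonIntegral a b) :
    IsContiguousPair a b (fun z => (1 - z) ^ (1 + a + b) * hyperPow a b (1 - z))
      (fun z => (1 + a + b) / a * ((1 - z) ^ (a + b) * hyperPow (a - 1) b (1 - z))) := by
  intro z hz
  have h1 := hyperPow_lower h hz.2
  have h2 := hyperPow_raise h hz.2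
  have hs := one_sub_mem_slitPlane hz.1
  have h0 := Complex.slitPlane_ne_zero hs
  have d0 : HasDerivAt (fun z : ℂ => 1 - z) (-1) z := by
    simpa using (hasDerivAt_id z).const_sub 1
  have d1 := (d0.cpow_const (c := 1 + a + b) hs).mul
    ((hyperPow_differentiableAt h hz.2).hasDerivAt.comp_const_sub 1 z)
  have d2 := ((d0.cpow_const (c := a + b) hs).mul
    ((hyperPow_differentiableAt h.sub_one hz.2).hasDerivAt.comp_const_sub 1 z)).const_mul
      ((1 + a + b) / a)
  have p1 : (1 - z) ^ (1 + a + b) = (1 - z) * (1 - z) ^ (a + b) := by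
    rw [add_assoc, Complex.cpow_add _ _ h0, Complex.cpow_one]
  have p2 : (1 - z) ^ (a + b) = (1 - z) * (1 - z) ^ (a + b - 1) := by
    nth_rw 2 [← Complex.cpow_one (1 - z)]
    rw [← Complex.cpow_add _ _ h0, add_sub_cancel]
  have ha := h.left_ne_zero
  have hab := h.one_add_add_ne_zero
  refine ⟨_, _, d1, d2, ?_, ?_⟩
  · simp only [show 1 + a + b - 1 = a + b by ring, p1]
    field_simp
    linear_combination -(1 - z) ^ (a + b) * h1
  · have h3 : (1 + a + b) / a * (z * deriv (hyperPow (a - 1) b) (1 - z) -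
        a * hyperPow (a - 1) b (1 - z)) = -a * hyperPow a b (1 - z) := by
      rw [sub_sub_cancel] at h2
      rw [h2]
      field_simp
    simp only [p1]
    rw [p2]
    linear_combination -(1 - z) ^ 2 * (1 - z) ^ (a + b - 1) * h3

namespace IsContiguousPair

variable {y t y₁ t₁ y₂ t₂ : ℂ → ℂ}

/-- A linear relation between first components passes to the second components. -/
lemma snd_eq (ha : a ≠ 0) (h : IsContiguousPair a b y t) (h₁ : IsContiguousPair a b y₁ t₁)
    (h₂ : IsContiguousPair a b y₂ t₂) {c₁ c₂ : ℂ}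
    (e : ∀ z ∈ lens, y z = c₁ * y₁ z + c₂ * y₂ z) {z : ℂ} (hz : z ∈ lens) :
    t z = c₁ * t₁ z + c₂ * t₂ z := by
  obtain ⟨y', -, d, -, k, -⟩ := h z hz
  obtain ⟨y₁', -, d₁, -, k₁, -⟩ := h₁ z hz
  obtain ⟨y₂', -, d₂, -, k₂, -⟩ := h₂ z hz
  have e' : y' = c₁ * y₁' + c₂ * y₂' := by
    refine d.unique (((d₁.const_mul c₁).add (d₂.const_mul c₂)).congr_of_eventuallyEq ?_)
    filter_upwards [isOpen_lens.mem_nhds hz] with w hw using e w hw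
  apply mul_left_cancel₀ ha
  linear_combination k - c₁ * k₁ - c₂ * k₂ - z * e' + a * e z hz

/-- A linear relation between second components passes to the first components. -/
lemma fst_eq (ha : a ≠ 0) (h : IsContiguousPair a b y t) (h₁ : IsContiguousPair a b y₁ t₁)
    (h₂ : IsContiguousPair a b y₂ t₂) {c₁ c₂ : ℂ}
    (e : ∀ z ∈ lens, t z = c₁ * t₁ z + c₂ * t₂ z) {z : ℂ} (hz : z ∈ lens) :
    y z = c₁ * y₁ z + c₂ * y₂ z := by
  obtain ⟨-, t', -, d, -, k⟩ := h z hz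
  obtain ⟨-, t₁', -, d₁, -, k₁⟩ := h₁ z hz
  obtain ⟨-, t₂', -, d₂, -, k₂⟩ := h₂ z hz
  have e' : t' = c₁ * t₁' + c₂ * t₂' := by
    refine d.unique (((d₁.const_mul c₁).add (d₂.const_mul c₂)).congr_of_eventuallyEq ?_)
    filter_upwards [isOpen_lens.mem_nhds hz] with w hw using e w hw
  apply mul_left_cancel₀ ha
  linear_combination -k + c₁ * k₁ + c₂ * k₂ + z * (1 - z) * e' + (a + b * z) * e z hz

/-- The Casoratian of two solutions, normalised, is constant. -/
lemma casoratian_eq (h₁ : IsContiguousPair a b y₁ t₁) (h₂ : IsContiguousPair a b y₂ t₂)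
    {z w : ℂ} (hz : z ∈ lens) (hw : w ∈ lens) :
    (1 - z) ^ (-(a + b)) * (y₁ z * t₂ z - t₁ z * y₂ z) =
      (1 - w) ^ (-(a + b)) * (y₁ w * t₂ w - t₁ w * y₂ w) := by
  -- The system has trace `a / z - (a + b z) / (z (1 - z)) = -(a + b) / (1 - z)`, so by Liouville's
  -- formula its determinants are multiples of `(1 - z) ^ (a + b)`.
  have key : ∀ z ∈ lens, HasDerivAt
      (fun z => (1 - z) ^ (-(a + b)) * (y₁ z * t₂ z - t₁ z * y₂ z)) 0 z := by
    intro z hz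
    obtain ⟨y₁', t₁', dy₁, dt₁, k₁, l₁⟩ := h₁ z hz
    obtain ⟨y₂', t₂', dy₂, dt₂, k₂, l₂⟩ := h₂ z hz
    have hs := one_sub_mem_slitPlane hz.1
    have h0 := Complex.slitPlane_ne_zero hs
    have d0 : HasDerivAt (fun z : ℂ => 1 - z) (-1) z := by
      simpa using (hasDerivAt_id z).const_sub 1
    have p : (1 - z) ^ (-(a + b)) = (1 - z) * (1 - z) ^ (-(a + b) - 1) := by
      nth_rw 2 [← Complex.cpow_one (1 - z)]
      rw [← Complex.cpow_add _ _ h0, add_sub_cancel]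
    refine ((d0.cpow_const (c := -(a + b)) hs).mul
      ((dy₁.mul dt₂).sub (dt₁.mul dy₂))).congr_deriv ?_
    apply mul_left_cancel₀ (ne_zero_of_mem_lens hz)
    simp only [Pi.mul_apply, Pi.sub_apply]
    rw [p]
    linear_combination (1 - z) ^ (-(a + b) - 1) * ((1 - z) * t₂ z * k₁ - (1 - z) * t₁ z * k₂ +
      y₁ z * l₂ - y₂ z * l₁)
  exact (convex_lens.is_const_of_fderivWithin_eq_zero (𝕜 := ℂ)
    (f := fun z => (1 - z) ^ (-(a + b)) * (y₁ z * t₂ z - t₁ z * y₂ z))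
    (fun z hz => (key z hz).differentiableAt.differentiableWithinAt)
    (fun z hz => by
      rw [fderivWithin_of_isOpen isOpen_lens hz]
      ext
      simpa using (key z hz).deriv)) hz hw

/-- Three solutions are linearly dependent, the coefficients being given by Casoratians. -/
lemma linear_relation (h : IsContiguousPair a b y t) (h₁ : IsContiguousPair a b y₁ t₁)
    (h₂ : IsContiguousPair a b y₂ t₂) {K L₁ L₂ : ℂ} {l : Filter ℂ} [l.NeBot] (hl : ∀ᶠ z in l, z ∈ lens)
    (hK : Filter.Tendsto (fun z => (1 - z) ^ (-(a + b)) * (y₁ z * t₂ z - t₁ z * y₂ z)) l (nhds K))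
    (hL₁ : Filter.Tendsto (fun z => (1 - z) ^ (-(a + b)) * (y z * t₂ z - t z * y₂ z)) l (nhds L₁))
    (hL₂ : Filter.Tendsto (fun z => (1 - z) ^ (-(a + b)) * (y₁ z * t z - t₁ z * y z)) l (nhds L₂))
    {z : ℂ} (hz : z ∈ lens) :
    K * y z = L₁ * y₁ z + L₂ * y₂ z := by
  have aux : ∀ {u v u' v' : ℂ → ℂ} {M : ℂ}, IsContiguousPair a b u v → IsContiguousPair a b u' v' →
      Filter.Tendsto (fun z => (1 - z) ^ (-(a + b)) * (u z * v' z - v z * u' z)) l (nhds M) →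
      M = (1 - z) ^ (-(a + b)) * (u z * v' z - v z * u' z) := by
    intro u v u' v' M hu hu' hM
    refine tendsto_nhds_unique hM (tendsto_const_nhds.congr' ?_)
    filter_upwards [hl] with w hw using casoratian_eq hu hu' hz hw
  -- With the constants replaced by the determinants at `z`, the claim is Cramer's rule.
  rw [aux h₁ h₂ hK, aux h h₂ hL₁, aux h₁ h hL₂]
  ring

end IsContiguousPair

/-! ### Euler's integral: analyticity, series, limit at `1`, transformation. -/

/-- The density `t ^ (u - 1) * (1 - t) ^ (v - 1)` of the beta integral. -/
noncomputable def betaKernel (u v t : ℝ) : ℝ := t ^ (u - 1) * (1 - t) ^ (v - 1)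

open MeasureTheory Set Filter

lemma betaKernel_nonneg {u v t : ℝ} (ht : t ∈ Ioo (0 : ℝ) 1) : 0 ≤ betaKernel u v t :=
  mul_nonneg (Real.rpow_nonneg ht.1.le _) (Real.rpow_nonneg (by linarith [ht.2]) _)

lemma ofReal_betaKernel {u v t : ℝ} (h0 : 0 ≤ t) (h1 : t ≤ 1) :
    ((betaKernel u v t : ℝ) : ℂ) = (t : ℂ) ^ ((u : ℂ) - 1) * (1 - (t : ℂ)) ^ ((v : ℂ) - 1) := by
  rw [betaKernel, Complex.ofReal_mul, Complex.ofReal_cpow h0, Complex.ofReal_cpow (by linarith)]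
  push_cast
  rfl

lemma measurable_betaKernel (u v : ℝ) : Measurable (betaKernel u v) := by
  unfold betaKernel
  fun_prop

lemma integrableOn_betaKernel {u v : ℝ} (hu : 0 < u) (hv : 0 < v) :
    IntegrableOn (betaKernel u v) (Ioo 0 1) := by
  have h := Complex.betaIntegral_convergent (u := u) (v := v) (by simpa) (by simpa)
  rw [intervalIntegrable_iff_integrableOn_Ioo_of_le zero_le_one] at h
  have h' : IntegrableOn _ (Ioo (0 : ℝ) 1) := h.re
  refine h'.congr_fun (fun t ht => ?_) measurableSet_Ioo
  change RCLike.re _ = _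
  rw [← ofReal_betaKernel ht.1.le ht.2.le]
  simp

lemma integral_betaKernel {u v : ℝ} (hu : 0 < u) (hv : 0 < v) :
    ∫ t in Ioo 0 1, betaKernel u v t = Real.Gamma u * Real.Gamma v / Real.Gamma (u + v) := by
  have h := Complex.betaIntegral_eq_Gamma_mul_div u v (by simpa) (by simpa)
  rw [Complex.betaIntegral, intervalIntegral.integral_of_le zero_le_one,
    integral_Ioc_eq_integral_Ioo, ← setIntegral_congr_fun measurableSet_Ioo
      (fun t (ht : t ∈ Ioo (0 : ℝ) 1) => ofReal_betaKernel ht.1.le ht.2.le),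
    integral_complex_ofReal, ← Complex.ofReal_add, Complex.Gamma_ofReal, Complex.Gamma_ofReal,
    Complex.Gamma_ofReal] at h
  exact_mod_cast h

lemma Gamma_add_natCast_eq {x : ℝ} (hx : 0 < x) (n : ℕ) :
    Real.Gamma (x + n) = Real.Gamma x * (ascPochhammer ℝ n).eval x := by
  induction n with
  | zero => simp
  | succ n ih =>
    rw [Nat.cast_succ, ← add_assoc, Real.Gamma_add_one (by positivity), ih, ascPochhammer_succ_eval]
    ring

lemma betaKernel_mul_pow {u v t : ℝ} (ht : 0 < t) (n : ℕ) :
    betaKernel u v t * t ^ n = betaKernel (u + n) v t := by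
  rw [betaKernel, betaKernel, add_sub_right_comm, Real.rpow_add_natCast ht.ne']
  ring

/-- The equal second and third parameters cancel, leaving the binomial coefficients `(-a)_n / n!`.
-/
lemma hasSum_one_sub_cpow (a : ℂ) {z : ℂ} (hz : ‖z‖ < 1) :
    HasSum (fun n => hypergeometricCoeff (-a) 1 1 n * z ^ n) ((1 - z) ^ a) := by
  have h := (Complex.one_add_cpow_hasFPowerSeriesOnBall_zero (a := a)).hasSum (y := -z)
    (by rw [← ENNReal.ofReal_one, Metric.eball_ofReal]; simpa using hz)
  rw [binomialSeries_eq_ordinaryHypergeometricSeries (b := 1)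
    (fun k hk => one_add_natCast_ne_zero k (by rw [hk]; ring))] at h
  rw [zero_add, ← sub_eq_add_neg] at h
  refine (hasSum_congr_fun fun n => ?_).1 h
  rw [FormalMultilinearSeries.compContinuousLinearMap_apply]
  have : (⇑(-(ContinuousLinearMap.id ℂ ℂ)) ∘ fun _ : Fin n => -z) = fun _ => z := by
    funext
    simp
  rw [this, ordinaryHypergeometricSeries, FormalMultilinearSeries.ofScalars_apply_eq, smul_eq_mul,
    hypergeometricCoeff]

/-- Euler's integral, without the normalising factor. -/
noncomputable def eulerIntegral (u v : ℝ) (a z : ℂ) : ℂ :=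
  ∫ t in Ioo (0 : ℝ) 1, (betaKernel u v t : ℂ) * (1 - z * t) ^ a

lemma one_sub_mul_mem_slitPlane {z : ℂ} (hz : 1 - z ∈ Complex.slitPlane) {t : ℝ} (h0 : 0 ≤ t)
    (h1 : t ≤ 1) : 1 - z * t ∈ Complex.slitPlane := by
  have := Complex.starConvex_one_slitPlane hz (sub_nonneg.2 h1) h0 (by ring)
  convert this using 1
  simp only [Complex.real_smul]
  push_cast
  ring

lemma isOpen_one_sub_slitPlane : IsOpen {z : ℂ | 1 - z ∈ Complex.slitPlane} :=
  Complex.isOpen_slitPlane.preimage (continuous_const.sub continuous_id)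

/-- Differentiation under the integral: over a small closed ball times `[0, 1]` the points `1 - w t`
stay in the slit plane, so by compactness the powers involved are bounded. -/
lemma eulerIntegral_differentiableAt {u v : ℝ} (hu : 0 < u) (hv : 0 < v) (a : ℂ) {z : ℂ}
    (hz : 1 - z ∈ Complex.slitPlane) : DifferentiableAt ℂ (eulerIntegral u v a) z := by
  obtain ⟨r, hr, hrs⟩ := Metric.nhds_basis_closedBall.mem_iff.1
    (isOpen_one_sub_slitPlane.mem_nhds hz)
  have hcont : ∀ c : ℂ, ContinuousOn (fun p : ℂ × ℝ => (1 - p.1 * (p.2 : ℂ)) ^ c)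
      (Metric.closedBall z r ×ˢ Icc 0 1) := fun c =>
    ContinuousOn.cpow_const (by fun_prop)
      fun p hp => one_sub_mul_mem_slitPlane (hrs hp.1) hp.2.1 hp.2.2
  have hcompact : IsCompact (Metric.closedBall z r ×ˢ Icc (0 : ℝ) 1) :=
    (isCompact_closedBall z r).prod isCompact_Icc
  obtain ⟨M, hM⟩ := hcompact.exists_bound_of_continuousOn (hcont a)
  obtain ⟨N, hN⟩ := hcompact.exists_bound_of_continuousOn (hcont (a - 1))
  have hint := integrableOn_betaKernel hu hv
  have hmeas : ∀ c : ℂ, ∀ w ∈ Metric.closedBall z r, AEStronglyMeasurable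
      (fun t : ℝ => (1 - w * t) ^ c) (volume.restrict (Ioo 0 1)) := fun c w hw =>
    ContinuousOn.aestronglyMeasurable (ContinuousOn.cpow_const (by fun_prop)
      fun t ht => one_sub_mul_mem_slitPlane (hrs hw) ht.1.le ht.2.le) measurableSet_Ioo
  have hk : AEStronglyMeasurable (fun t => (betaKernel u v t : ℂ)) (volume.restrict (Ioo 0 1)) :=
    (Complex.measurable_ofReal.comp (measurable_betaKernel u v)).aestronglyMeasurable
  have hzz : z ∈ Metric.closedBall z r := Metric.mem_closedBall_self hr.le
  refine (hasDerivAt_integral_of_dominated_loc_of_deriv_le (𝕜 := ℂ)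
    (μ := volume.restrict (Ioo 0 1))
    (F := fun w t => (betaKernel u v t : ℂ) * (1 - w * t) ^ a)
    (F' := fun w t => (betaKernel u v t : ℂ) * (a * (1 - w * t) ^ (a - 1) * (-t)))
    (bound := fun t => betaKernel u v t * (‖a‖ * N))
    (Metric.closedBall_mem_nhds z hr) ?_ ?_ ?_ ?_ ?_ ?_).2.differentiableAt
  · filter_upwards [Metric.closedBall_mem_nhds z hr] with w hw using hk.mul (hmeas a w hw)
  · refine (hint.ofReal (𝕜 := ℂ)).mul_bdd (c := M) (hmeas a z hzz) ?_
    filter_upwards [ae_restrict_mem measurableSet_Ioo] with t ht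
    exact hM (z, t) ⟨hzz, ht.1.le, ht.2.le⟩
  · refine hk.mul (((hmeas (a - 1) z hzz).const_mul a).mul ?_)
    exact (Complex.measurable_ofReal.neg).aestronglyMeasurable
  · filter_upwards [ae_restrict_mem measurableSet_Ioo] with t ht w hw
    rw [norm_mul, norm_mul, norm_mul, norm_neg, Complex.norm_real, Complex.norm_real,
      Real.norm_of_nonneg (betaKernel_nonneg ht), Real.norm_of_nonneg ht.1.le]
    refine mul_le_mul_of_nonneg_left ?_ (betaKernel_nonneg ht)
    calc ‖a‖ * ‖(1 - w * (t : ℂ)) ^ (a - 1)‖ * t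
        ≤ ‖a‖ * ‖(1 - w * (t : ℂ)) ^ (a - 1)‖ * 1 := by gcongr; exact ht.2.le
      _ ≤ ‖a‖ * N := by
        rw [mul_one]
        gcongr
        exact hN (w, t) ⟨hw, ht.1.le, ht.2.le⟩
  · exact hint.mul_const _
  · filter_upwards [ae_restrict_mem measurableSet_Ioo] with t ht w hw
    have d0 : HasDerivAt (fun w : ℂ => 1 - w * t) (-t) w := by
      simpa using ((hasDerivAt_id w).mul_const (t : ℂ)).const_sub 1
    exact (d0.cpow_const (one_sub_mul_mem_slitPlane (hrs hw) ht.1.le ht.2.le)).const_mul _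

/-- The binomial series is integrated term by term. The beta exponents `-b + n` and `1 + b` add up
to `n + 1`, so the denominators `Γ(n + 1) = n!` supply the third parameter `1`. -/
lemma eulerIntegral_eq {b : ℝ} (hb0 : -1 < b) (hb1 : b < 0) {a : ℂ} (h : NonIntegral a b) {z : ℂ} (hz : ‖z‖ < 1) :
    eulerIntegral (-b) (1 + b) a z =
      ((Real.Gamma (-b) * Real.Gamma (1 + b) : ℝ) : ℂ) * hyperZero a b z := by
  set F : ℕ → ℝ → ℂ := fun n t => (hypergeometricCoeff (-a) 1 1 n * z ^ n) *
    (betaKernel (-b + n) (1 + b) t : ℂ) with hF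
  have hu : 0 < -b := by linarith
  have hv : 0 < 1 + b := by linarith
  have hun : ∀ n : ℕ, 0 < -b + n := fun n => by positivity
  have hFint : ∀ n, Integrable (F n) (volume.restrict (Ioo 0 1)) := fun n =>
    ((integrableOn_betaKernel (hun n) hv).ofReal (𝕜 := ℂ)).const_mul _
  have hsum : Summable fun n => ∫ t in Ioo 0 1, ‖F n t‖ := by
    refine Summable.of_nonneg_of_le (fun n => integral_nonneg fun t => norm_nonneg _) (fun n => ?_)
      ((hasSum_one_sub_cpow a hz).summable.norm.mul_right (∫ t in Ioo 0 1, betaKernel (-b) (1 + b) t))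
    rw [← integral_const_mul]
    refine setIntegral_mono_on (hFint n).norm ((integrableOn_betaKernel hu hv).const_mul _)
      measurableSet_Ioo fun t ht => ?_
    rw [hF, norm_mul, ← betaKernel_mul_pow ht.1, Complex.norm_real, Real.norm_of_nonneg
      (mul_nonneg (betaKernel_nonneg ht) (pow_nonneg ht.1.le n))]
    exact mul_le_mul_of_nonneg_left (mul_le_of_le_one_right (betaKernel_nonneg ht)
      (pow_le_one₀ ht.1.le ht.2.le)) (norm_nonneg _)
  have key := hasSum_integral_of_summable_integral_norm hFint hsum
  have e1 : ∫ t in Ioo 0 1, ∑' n, F n t = eulerIntegral (-b) (1 + b) a z := by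
    refine setIntegral_congr_fun measurableSet_Ioo fun t ht => ?_
    have hzt : ‖z * t‖ < 1 := by
      rw [norm_mul, Complex.norm_real, Real.norm_of_nonneg ht.1.le]
      exact (mul_le_of_le_one_right (norm_nonneg z) ht.2.le).trans_lt hz
    refine HasSum.tsum_eq ((hasSum_congr_fun fun n => ?_).1
      ((hasSum_one_sub_cpow a hzt).mul_left (betaKernel (-b) (1 + b) t : ℂ)))
    rw [hF]
    simp only [← betaKernel_mul_pow ht.1]
    push_cast
    ring
  rw [e1] at key
  have e2 : ∀ n, ∫ t in Ioo 0 1, F n t = ((Real.Gamma (-b) * Real.Gamma (1 + b) : ℝ) : ℂ) *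
      (hypergeometricCoeff (-a) (-b) 1 n * z ^ n) := by
    intro n
    rw [hF, integral_const_mul, integral_complex_ofReal, integral_betaKernel (hun n) hv,
      Gamma_add_natCast_eq hu, show -b + n + (1 + b) = (n : ℝ) + 1 by ring,
      Real.Gamma_nat_eq_factorial]
    have h1 : (ascPochhammer ℂ n).eval (1 : ℂ) = n.factorial := by simp
    have h2 : (((ascPochhammer ℝ n).eval (-b) : ℝ) : ℂ) = (ascPochhammer ℂ n).eval (-(b : ℂ)) := by
      have := ascPochhammer_eval₂ Complex.ofRealHom n (Complex.ofRealHom (-b))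
      rw [Polynomial.eval₂_at_apply] at this
      simpa using this.symm
    have h3 : (n.factorial : ℂ) ≠ 0 := by exact_mod_cast n.factorial_ne_zero
    simp only [hypergeometricCoeff, ordinaryHypergeometricCoefficient, h1]
    push_cast
    rw [h2]
    field_simp
  simp only [e2] at key
  exact key.unique ((ordinaryHypergeometric_hasSum h.neg_left h.symm.neg_left one_add_natCast_ne_zero hz).mul_left _)

lemma ofReal_one_sub_mul_cpow {x t : ℝ} (hx : x ≤ 1) (ht : t ∈ Ioo (0 : ℝ) 1)
    (c : ℝ) : (1 - (x : ℂ) * t) ^ (c : ℂ) = (((1 - x * t) ^ c : ℝ) : ℂ) := by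
  have : 0 ≤ 1 - x * t := by nlinarith [ht.1, ht.2]
  rw [Complex.ofReal_cpow this]
  push_cast
  rfl

lemma betaKernel_mul_rpow {u v t : ℝ} (ht : t < 1) (c : ℝ) :
    betaKernel u v t * (1 - t) ^ c = betaKernel u (v + c) t := by
  rw [betaKernel, betaKernel, add_sub_right_comm, Real.rpow_add (by linarith)]
  ring

/-- The behaviour of Euler's integral at `1` in the convergent case. -/
lemma tendsto_eulerIntegral {u v c : ℝ} (hu : 0 < u) (hv : 0 < v) (hvc : 0 < v + c) :
    Tendsto (fun x : ℝ => eulerIntegral u v c x) (nhdsWithin 1 (Iio 1))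
      (nhds ((Real.Gamma u * Real.Gamma (v + c) / Real.Gamma (u + (v + c)) : ℝ) : ℂ)) := by
  have hlim : ((Real.Gamma u * Real.Gamma (v + c) / Real.Gamma (u + (v + c)) : ℝ) : ℂ) =
      ∫ t in Ioo (0 : ℝ) 1, ((betaKernel u (v + c) t : ℝ) : ℂ) := by
    rw [integral_complex_ofReal, integral_betaKernel hu hvc]
  rw [hlim]
  have hev : ∀ᶠ x : ℝ in nhdsWithin 1 (Iio 1), x ∈ Ioo (0 : ℝ) 1 := Ioo_mem_nhdsLT one_pos
  have hmeas : ∀ x : ℝ, AEStronglyMeasurable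
      (fun t : ℝ => ((betaKernel u v t : ℝ) : ℂ) * (1 - (x : ℂ) * t) ^ (c : ℂ))
      (volume.restrict (Ioo 0 1)) := fun x => by
    have := measurable_betaKernel u v
    exact Measurable.aestronglyMeasurable (by fun_prop)
  -- Since `1 - t ≤ 1 - x t ≤ 1`, the power `(1 - x t) ^ c` is at most `1 + (1 - t) ^ c` for either
  -- sign of `c`.
  refine tendsto_integral_filter_of_dominated_convergence
    (fun t => betaKernel u v t + betaKernel u (v + c) t) (Eventually.of_forall hmeas) ?_
    ((integrableOn_betaKernel hu hv).add (integrableOn_betaKernel hu hvc)) ?_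
  · filter_upwards [hev] with x hx
    filter_upwards [ae_restrict_mem measurableSet_Ioo] with t ht
    have h1 : 0 < 1 - t := by linarith [ht.2]
    have h2 : 1 - t ≤ 1 - x * t := by nlinarith [ht.1, hx.2]
    have h3 : 1 - x * t ≤ 1 := by nlinarith [ht.1, hx.1]
    rw [ofReal_one_sub_mul_cpow hx.2.le ht, norm_mul, Complex.norm_real, Complex.norm_real,
      Real.norm_of_nonneg (betaKernel_nonneg ht),
      Real.norm_of_nonneg (Real.rpow_nonneg (h1.le.trans h2) c), ← betaKernel_mul_rpow ht.2,
      ← mul_one_add]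
    refine mul_le_mul_of_nonneg_left ?_ (betaKernel_nonneg ht)
    rcases le_total 0 c with hc | hc
    · exact (Real.rpow_le_one (h1.le.trans h2) h3 hc).trans
        (le_add_of_nonneg_right (Real.rpow_nonneg h1.le c))
    · exact (Real.rpow_le_rpow_of_nonpos h1 h2 hc).trans (le_add_of_nonneg_left zero_le_one)
  · filter_upwards [ae_restrict_mem measurableSet_Ioo] with t ht
    have h1 : 0 < 1 - t := by linarith [ht.2]
    have : Tendsto (fun x : ℝ => betaKernel u v t * (1 - x * t) ^ c) (nhdsWithin 1 (Iio 1))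
        (nhds (betaKernel u (v + c) t)) := by
      rw [← betaKernel_mul_rpow ht.2]
      refine Tendsto.const_mul _ (tendsto_nhdsWithin_of_tendsto_nhds ?_)
      have : ContinuousAt (fun x : ℝ => (1 - x * t) ^ c) 1 :=
        ContinuousAt.rpow_const (by fun_prop) (Or.inl (by simpa using h1.ne'))
      simpa [ContinuousAt] using this
    refine ((Complex.continuous_ofReal.tendsto _).comp this).congr' ?_
    filter_upwards [hev] with x hx
    rw [ofReal_one_sub_mul_cpow hx.2.le ht, Function.comp_apply, Complex.ofReal_mul]

lemma image_one_sub_div_one_sub_mul {x : ℝ} (hx : x ∈ Ioo (0 : ℝ) 1) :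
    (fun τ : ℝ => (1 - τ) / (1 - x * τ)) '' Ioo 0 1 = Ioo 0 1 := by
  have hpos : ∀ τ ∈ Ioo (0 : ℝ) 1, 0 < 1 - x * τ := fun τ hτ => by nlinarith [hτ.1, hτ.2, hx.1, hx.2]
  have hmaps : ∀ τ ∈ Ioo (0 : ℝ) 1, (1 - τ) / (1 - x * τ) ∈ Ioo (0 : ℝ) 1 := fun τ hτ =>
    ⟨div_pos (by linarith [hτ.2]) (hpos τ hτ),
      (div_lt_one (hpos τ hτ)).2 (by nlinarith [hτ.1, hx.2])⟩
  -- The map is an involution, so a preimage of `t` is its own image.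
  refine Subset.antisymm (image_subset_iff.2 hmaps) fun t ht => ⟨_, hmaps t ht, ?_⟩
  have h1 := (hpos t ht).ne'
  have h2 : 1 - x ≠ 0 := by linarith [hx.2]
  have h3 : 1 - x * ((1 - t) / (1 - x * t)) = (1 - x) / (1 - x * t) := by
    field_simp
    ring
  have h4 : 1 - (1 - t) / (1 - x * t) = t * (1 - x) / (1 - x * t) := by
    rw [eq_div_iff h1, sub_mul, div_mul_cancel₀ _ h1]
    ring
  simp only [h3, h4]
  rw [div_div_div_cancel_right₀ h1, mul_div_cancel_right₀ _ h2]

/-- Euler's transformation, for the integral. -/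
lemma eulerIntegral_transform (u v c : ℝ) {x : ℝ} (hx : x ∈ Ioo (0 : ℝ) 1) :
    eulerIntegral u v c x =
      (((1 - x) ^ (v + c) : ℝ) : ℂ) * eulerIntegral v u ((-(u + v + c) : ℝ) : ℂ) x := by
  have hpos : ∀ τ ∈ Ioo (0 : ℝ) 1, 0 < 1 - x * τ := fun τ hτ => by nlinarith [hτ.1, hτ.2, hx.1, hx.2]
  have hw : 0 < 1 - x := by linarith [hx.2]
  have hderiv : ∀ τ ∈ Ioo (0 : ℝ) 1, HasDerivWithinAt (fun τ : ℝ => (1 - τ) / (1 - x * τ))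
      (-(1 - x) / (1 - x * τ) ^ 2) (Ioo 0 1) τ := by
    intro τ hτ
    have d1 : HasDerivAt (fun τ : ℝ => 1 - τ) (-1) τ := by
      simpa using (hasDerivAt_id τ).const_sub 1
    have d2 : HasDerivAt (fun τ : ℝ => 1 - x * τ) (-x) τ := by
      simpa using ((hasDerivAt_id τ).const_mul x).const_sub 1
    refine ((d1.div d2 (hpos τ hτ).ne').congr_deriv ?_).hasDerivWithinAt
    congr 1
    ring
  have hinj : InjOn (fun τ : ℝ => (1 - τ) / (1 - x * τ)) (Ioo 0 1) := by
    intro τ hτ σ hσ h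
    simp only [div_eq_div_iff (hpos τ hτ).ne' (hpos σ hσ).ne'] at h
    apply mul_left_cancel₀ hw.ne'
    linear_combination -h
  have key := integral_image_eq_integral_abs_deriv_smul measurableSet_Ioo hderiv hinj
    (fun t : ℝ => (betaKernel u v t : ℂ) * (1 - x * t) ^ (c : ℂ))
  rw [image_one_sub_div_one_sub_mul hx] at key
  rw [eulerIntegral, key, eulerIntegral, ← integral_const_mul]
  refine setIntegral_congr_fun measurableSet_Ioo fun τ hτ => ?_
  have hτ' : (1 - τ) / (1 - x * τ) ∈ Ioo (0 : ℝ) 1 := by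
    rw [← image_one_sub_div_one_sub_mul hx]
    exact mem_image_of_mem _ hτ
  simp only [ofReal_one_sub_mul_cpow hx.2.le hτ, ofReal_one_sub_mul_cpow hx.2.le hτ']
  simp only [Complex.real_smul, ← Complex.ofReal_mul, Complex.ofReal_inj]
  have p := hpos τ hτ
  have h1 : 0 < 1 - τ := by linarith [hτ.2]
  have h3 : 1 - x * ((1 - τ) / (1 - x * τ)) = (1 - x) / (1 - x * τ) := by
    field_simp
    ring
  have h4 : 1 - (1 - τ) / (1 - x * τ) = τ * (1 - x) / (1 - x * τ) := by
    rw [eq_div_iff p.ne', sub_mul, div_mul_cancel₀ _ p.ne']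
    ring
  rw [betaKernel, betaKernel, h3, h4, abs_div, abs_neg, abs_of_pos hw, abs_of_pos (by positivity),
    Real.div_rpow h1.le p.le, Real.div_rpow (by have := hτ.1; positivity) p.le,
    Real.div_rpow hw.le p.le, Real.mul_rpow hτ.1.le hw.le, Real.rpow_neg p.le,
    Real.rpow_sub_one p.ne', Real.rpow_sub_one p.ne', Real.rpow_add p, Real.rpow_add p,
    Real.rpow_add hw, Real.rpow_sub_one hw.ne']
  field_simp

/-! ### The connection formula. -/

/-- The coefficient of `hyperOne` in the connection formula for `hyperZero`. -/
noncomputable def connOne (a b : ℂ) : ℂ :=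
  Complex.Gamma (1 + a + b) / (Complex.Gamma (1 + a) * Complex.Gamma (1 + b))

/-- The coefficient of `hyperPow` in the connection formula for `hyperZero`. -/
noncomputable def connPow (a b : ℂ) : ℂ :=
  Complex.Gamma (-a - b - 1) / (Complex.Gamma (-a) * Complex.Gamma (-b))

lemma connOne_symm (a b : ℂ) : connOne a b = connOne b a := by
  rw [connOne, connOne, mul_comm, add_right_comm]

lemma connPow_symm (a b : ℂ) : connPow a b = connPow b a := by
  rw [connPow, connPow, mul_comm, show -a - b = -b - a by ring]

/-- The factor is that of the second component in `isContiguousPair_hyperOne`; likewise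
`connPow_sub_one` matches `isContiguousPair_hyperPow`. Thus one pair of constants serves both
components. -/
lemma connOne_sub_one (h : NonIntegral a b) :
    connOne (a - 1) b = connOne a b * (a / (a + b)) := by
  have ha := h.left_ne_zero
  have hab := h.add_ne_zero
  rw [connOne, connOne, show 1 + a + b = a + b + 1 by ring, add_comm 1 a,
    Complex.Gamma_add_one _ ha, Complex.Gamma_add_one _ hab, show 1 + (a - 1) = a by ring]
  field_simp

lemma connPow_sub_one (h : NonIntegral a b) :
    connPow (a - 1) b = connPow a b * ((1 + a + b) / a) := by
  have ha : -a ≠ 0 := neg_ne_zero.2 h.left_ne_zero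
  have ha' := h.left_ne_zero
  have hab : -a - b - 1 ≠ 0 := by
    simpa [sub_eq_add_neg] using h.neg_add_ne (-1)
  rw [connPow, connPow, show -(a - 1) - b - 1 = -a - b - 1 + 1 by ring,
    show -(a - 1) = -a + 1 by ring, Complex.Gamma_add_one _ ha, Complex.Gamma_add_one _ hab]
  field_simp
  ring

/-- The connection formula expressing `hyperZero` through the solutions at `1`. -/
def Connected (a b : ℂ) : Prop :=
  ∀ z ∈ lens, hyperZero a b z = connOne a b * hyperOne a b (1 - z) +
    connPow a b * ((1 - z) ^ (1 + a + b) * hyperPow a b (1 - z))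

lemma Connected.symm (h : Connected a b) : Connected b a := fun z hz => by
  rw [hyperZero_symm, h z hz, connOne_symm, connPow_symm, hyperOne_symm, hyperPow_symm,
    add_right_comm]

/-- With the normalisations above, the formula for `a - 1` is the relation between second components
with the constants of `a`, and the system passes it to and from the first components. -/
lemma connected_sub_one_iff (h : NonIntegral a b) : Connected (a - 1) b ↔ Connected a b := by
  have e : Connected (a - 1) b ↔ ∀ z ∈ lens, hyperZero (a - 1) b z =
      connOne a b * (a / (a + b) * hyperOne (a - 1) b (1 - z)) +
      connPow a b * ((1 + a + b) / a * ((1 - z) ^ (a + b) * hyperPow (a - 1) b (1 - z))) := by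
    refine forall₂_congr fun z hz => ?_
    rw [connOne_sub_one h, connPow_sub_one h, show 1 + (a - 1) + b = a + b by ring, mul_assoc,
      mul_assoc]
  rw [e]
  exact ⟨fun hc z hz => (isContiguousPair_hyperZero h).fst_eq h.left_ne_zero
      (isContiguousPair_hyperOne h) (isContiguousPair_hyperPow h) hc hz,
    fun hc z hz => (isContiguousPair_hyperZero h).snd_eq h.left_ne_zero
      (isContiguousPair_hyperOne h) (isContiguousPair_hyperPow h) hc hz⟩

lemma Gamma_ofReal_ne_zero_of_pos {x : ℝ} (hx : 0 < x) : Complex.Gamma x ≠ 0 :=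
  Complex.Gamma_ne_zero_of_re_pos (by simpa)

lemma tendsto_one_sub_cpow {c : ℝ} (hc : 0 < c) :
    Tendsto (fun x : ℝ => (1 - (x : ℂ)) ^ (c : ℂ)) (nhdsWithin 1 (Iio 1)) (nhds 0) := by
  have h : Tendsto (fun x : ℝ => (1 - x) ^ c) (nhdsWithin 1 (Iio 1)) (nhds 0) := by
    have : ContinuousAt (fun x : ℝ => (1 - x) ^ c) 1 :=
      ContinuousAt.rpow_const (by fun_prop) (Or.inr hc.le)
    simpa [ContinuousAt, Real.zero_rpow hc.ne'] using tendsto_nhdsWithin_of_tendsto_nhds this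
  refine ((Complex.continuous_ofReal.tendsto _).comp h).congr' ?_
  filter_upwards [self_mem_nhdsWithin] with x hx
  rw [Function.comp_apply, Complex.ofReal_cpow (by linarith [mem_Iio.1 hx])]
  push_cast
  rfl

lemma ofReal_mem_lens {x : ℝ} (hx : x ∈ Ioo (0 : ℝ) 1) : (x : ℂ) ∈ lens := by
  have h : (1 - x : ℂ) = ((1 - x : ℝ) : ℂ) := by push_cast; rfl
  refine ⟨?_, ?_⟩
  · rw [Complex.norm_real, Real.norm_of_nonneg hx.1.le]
    exact hx.2
  · rw [h, Complex.norm_real, Real.norm_of_nonneg (by linarith [hx.2])]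
    linarith [hx.1]

/-- Gauss's summation theorem. -/
lemma tendsto_hyperZero {a b : ℝ} (hb0 : -1 < b) (hb1 : b < 0) (hab : -1 < a + b)
    (h : NonIntegral a b) :
    Tendsto (fun x : ℝ => hyperZero a b x) (nhdsWithin 1 (Iio 1)) (nhds (connOne a b)) := by
  have hu : 0 < -b := by linarith
  have hv : 0 < 1 + b := by linarith
  have g1 := Gamma_ofReal_ne_zero_of_pos hu
  have g2 := Gamma_ofReal_ne_zero_of_pos hv
  have key := (tendsto_eulerIntegral hu hv (show 0 < 1 + b + a by linarith)).const_mul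
    ((Real.Gamma (-b) * Real.Gamma (1 + b) : ℝ) : ℂ)⁻¹
  have e : ((Real.Gamma (-b) * Real.Gamma (1 + b) : ℝ) : ℂ)⁻¹ *
      ((Real.Gamma (-b) * Real.Gamma (1 + b + a) / Real.Gamma (-b + (1 + b + a)) : ℝ) : ℂ) =
      connOne a b := by
    rw [connOne]
    push_cast [← Complex.Gamma_ofReal]
    push_cast at g1 g2
    rw [show -(b : ℂ) + (1 + b + a) = 1 + a by ring, show (1 : ℂ) + b + a = 1 + a + b by ring]
    field_simp
  rw [e] at key
  refine key.congr' ?_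
  filter_upwards [Ioo_mem_nhdsLT one_pos] with x hx
  rw [eulerIntegral_eq hb0 hb1 h (ofReal_mem_lens hx).1]
  refine inv_mul_cancel_left₀ ?_ _
  rw [Complex.ofReal_mul, ← Complex.Gamma_ofReal, ← Complex.Gamma_ofReal]
  exact mul_ne_zero g1 g2

/-- As `a + b < 0`, the function blows up at `1`. Euler's transformation extracts the factor `(1 -
x) ^ (a + b)` and leaves an integral that converges at `1` to a beta value. -/
lemma tendsto_hyperZero_sub_one {a b : ℝ} (hb0 : -1 < b) (hb1 : b < 0) (hab : a + b < 0)
    (h : NonIntegral a b) :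
    Tendsto (fun x : ℝ => (1 - (x : ℂ)) ^ (-((a : ℂ) + b)) * hyperZero (a - 1) b x)
      (nhdsWithin 1 (Iio 1)) (nhds (connPow a b * ((1 + a + b) / a))) := by
  have hu : 0 < -b := by linarith
  have hv : 0 < 1 + b := by linarith
  have g1 := Gamma_ofReal_ne_zero_of_pos hu
  have g2 := Gamma_ofReal_ne_zero_of_pos hv
  have key := (tendsto_eulerIntegral hv hu (show 0 < -b + -a by linarith)).const_mul
    ((Real.Gamma (-b) * Real.Gamma (1 + b) : ℝ) : ℂ)⁻¹
  have e : ((Real.Gamma (-b) * Real.Gamma (1 + b) : ℝ) : ℂ)⁻¹ *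
      ((Real.Gamma (1 + b) * Real.Gamma (-b + -a) / Real.Gamma (1 + b + (-b + -a)) : ℝ) : ℂ) =
      connPow a b * ((1 + a + b) / a) := by
    rw [← connPow_sub_one h, connPow]
    push_cast [← Complex.Gamma_ofReal]
    push_cast at g1 g2
    rw [show (1 + (b : ℂ) + (-b + -a)) = -(a - 1) by ring,
      show -((a : ℂ) - 1) - b - 1 = -b + -a by ring]
    field_simp
  rw [e] at key
  refine key.congr' ?_
  filter_upwards [Ioo_mem_nhdsLT one_pos] with x hx
  have hw : 0 < 1 - x := by linarith [hx.2]
  have h1 := eulerIntegral_eq hb0 hb1 h.sub_one (ofReal_mem_lens hx).1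
  have h2 := eulerIntegral_transform (-b) (1 + b) (a - 1) hx
  rw [show -(-b + (1 + b) + (a - 1)) = -a by ring, show 1 + b + (a - 1) = a + b by ring,
    Complex.ofReal_sub, Complex.ofReal_one, h1] at h2
  have hG : ((Real.Gamma (-b) * Real.Gamma (1 + b) : ℝ) : ℂ) ≠ 0 := by
    rw [Complex.ofReal_mul, ← Complex.Gamma_ofReal, ← Complex.Gamma_ofReal]
    exact mul_ne_zero g1 g2
  have h3 : (1 - (x : ℂ)) ^ (-((a : ℂ) + b)) * (((1 - x) ^ (a + b) : ℝ) : ℂ) = 1 := by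
    rw [Complex.ofReal_cpow hw.le]
    push_cast
    rw [← Complex.cpow_add _ _ (by exact_mod_cast hw.ne'), neg_add_cancel, Complex.cpow_zero]
  rw [inv_mul_eq_iff_eq_mul₀ hG]
  linear_combination -(1 - (x : ℂ)) ^ (-((a : ℂ) + b)) * h2 -
    eulerIntegral (1 + b) (-b) ((-a : ℝ) : ℂ) x * h3

lemma tendsto_comp_one_sub {f : ℂ → ℂ} (hf : DifferentiableAt ℂ f 0) :
    Tendsto (fun x : ℝ => f (1 - x)) (nhdsWithin 1 (Iio 1)) (nhds (f 0)) := by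
  have : ContinuousAt (fun x : ℝ => f (1 - x)) 1 := by
    refine ContinuousAt.comp' ?_ (by fun_prop)
    simpa using hf.continuousAt
  simpa [ContinuousAt] using tendsto_nhdsWithin_of_tendsto_nhds this

/-- The bounds on `a + b` make both `(1 - x) ^ (1 + a + b)` and `(1 - x) ^ (-(a + b))` tend to `0`,
so in each Casoratian a single product survives as `x → 1`. -/
lemma connected_of_mem_Ioo {a b : ℝ} (hb0 : -1 < b) (hb1 : b < 0) (hab : -1 < a + b)
    (hab' : a + b < 0) (h : NonIntegral a b) : Connected a b := by
  intro z hz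
  have hz0 : ‖(0 : ℂ)‖ < 1 := by simp
  have A := tendsto_comp_one_sub (hyperOne_differentiableAt h hz0)
  have A' := tendsto_comp_one_sub (hyperOne_differentiableAt h.sub_one hz0)
  have B := tendsto_comp_one_sub (hyperPow_differentiableAt h hz0)
  have B' := tendsto_comp_one_sub (hyperPow_differentiableAt h.sub_one hz0)
  have F := tendsto_hyperZero hb0 hb1 hab h
  have F' := tendsto_hyperZero_sub_one hb0 hb1 hab' h
  have W : Tendsto (fun x : ℝ => 1 - (x : ℂ)) (nhdsWithin 1 (Iio 1)) (nhds 0) := by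
    simpa using tendsto_one_sub_cpow one_pos
  have Ws : Tendsto (fun x : ℝ => (1 - (x : ℂ)) ^ (1 + (a : ℂ) + b)) (nhdsWithin 1 (Iio 1))
      (nhds 0) := by
    simpa [add_assoc] using tendsto_one_sub_cpow (show 0 < 1 + (a + b) by linarith)
  have Wn : Tendsto (fun x : ℝ => (1 - (x : ℂ)) ^ (-((a : ℂ) + b))) (nhdsWithin 1 (Iio 1))
      (nhds 0) := by
    simpa using tendsto_one_sub_cpow (show 0 < -(a + b) by linarith)
  have o1 : hyperOne (a : ℂ) b 0 = 1 := ordinaryHypergeometric_zero _ _ _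
  have o2 : hyperOne ((a : ℂ) - 1) b 0 = 1 := ordinaryHypergeometric_zero _ _ _
  have o3 : hyperPow (a : ℂ) b 0 = 1 := ordinaryHypergeometric_zero _ _ _
  have o4 : hyperPow ((a : ℂ) - 1) b 0 = 1 := ordinaryHypergeometric_zero _ _ _
  rw [o1] at A
  rw [o2] at A'
  rw [o3] at B
  rw [o4] at B'
  have cancel : ∀ x : ℝ, x ∈ Ioo (0 : ℝ) 1 →
      (1 - (x : ℂ)) ^ (-((a : ℂ) + b)) * (1 - (x : ℂ)) ^ ((a : ℂ) + b) = 1 ∧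
      (1 - (x : ℂ)) ^ (1 + (a : ℂ) + b) = (1 - x) * (1 - (x : ℂ)) ^ ((a : ℂ) + b) := by
    intro x hx
    have h0 := Complex.slitPlane_ne_zero (one_sub_mem_slitPlane (ofReal_mem_lens hx).1)
    refine ⟨?_, ?_⟩
    · rw [← Complex.cpow_add _ _ h0, neg_add_cancel, Complex.cpow_zero]
    · rw [add_assoc, Complex.cpow_add _ _ h0, Complex.cpow_one]
  have ev : ∀ᶠ x : ℝ in nhdsWithin 1 (Iio 1), x ∈ Ioo (0 : ℝ) 1 := Ioo_mem_nhdsLT one_pos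
  have key := (isContiguousPair_hyperZero h).linear_relation (isContiguousPair_hyperOne h)
    (isContiguousPair_hyperPow h) (K := (1 + a + b) / a) (L₁ := (1 + a + b) / a * connOne a b)
    (L₂ := connPow a b * ((1 + a + b) / a))
    (l := map (fun x : ℝ => (x : ℂ)) (nhdsWithin 1 (Iio 1)))
    (eventually_map.2 (ev.mono fun x hx => ofReal_mem_lens hx)) ?_ ?_ ?_ hz
  · have hs := h.one_add_add_ne_zero
    have ha := h.left_ne_zero
    apply mul_left_cancel₀ (div_ne_zero hs ha)
    linear_combination key
  · rw [tendsto_map'_iff]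
    have := (((A.mul B').const_mul ((1 + (a : ℂ) + b) / a))).sub
      (((A'.mul W).mul B).const_mul ((a : ℂ) / (a + b)))
    simp only [mul_one, mul_zero, sub_zero] at this
    refine this.congr' (ev.mono fun x hx => ?_)
    obtain ⟨c1, c2⟩ := cancel x hx
    simp only [Function.comp_apply, c2]
    linear_combination (-(hyperOne a b (1 - x) * ((1 + a + b) / a) * hyperPow (a - 1) b (1 - x)) +
      a / (a + b) * hyperOne (a - 1) b (1 - x) * (1 - x) * hyperPow a b (1 - x)) * c1
  · rw [tendsto_map'_iff]
    have := ((F.mul B').const_mul ((1 + (a : ℂ) + b) / a)).sub ((F'.mul Ws).mul B)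
    simp only [mul_one, mul_zero, sub_zero] at this
    refine this.congr' (ev.mono fun x hx => ?_)
    obtain ⟨c1, c2⟩ := cancel x hx
    simp only [Function.comp_apply]
    linear_combination -(hyperZero a b x * ((1 + a + b) / a) * hyperPow (a - 1) b (1 - x)) * c1
  · rw [tendsto_map'_iff]
    have := (A.mul F').sub (((A'.mul F).mul Wn).const_mul ((a : ℂ) / (a + b)))
    simp only [one_mul, mul_zero, sub_zero] at this
    refine this.congr' (ev.mono fun x hx => ?_)
    simp only [Function.comp_apply]
    ring

/-- A symmetric property of pairs which is invariant under a unit shift of the first entry holds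
for all admissible real pairs if it holds in a fundamental domain. -/
lemma NonIntegral.induction {P : ℂ → ℂ → Prop}
    (base : ∀ a b : ℝ, -1 < b → b < 0 → -1 < a + b → a + b < 0 → NonIntegral a b → P a b)
    (symm : ∀ a b, P a b → P b a)
    (shift : ∀ a b, NonIntegral a b → (P (a - 1) b ↔ P a b)) {a b : ℝ} (h : NonIntegral a b) :
    P a b := by
  have shifts : ∀ (k : ℤ) (a b : ℂ), NonIntegral a b → P a b → P (a + k) b := by
    intro k a b hab hP
    induction k using Int.induction_on with
    | zero => simpa using hP
    | succ n ih =>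
      have := (shift _ _ (hab.shift (n + 1))).1
      push_cast at this ih ⊢
      exact this (by convert ih using 1; ring)
    | pred n ih =>
      have := (shift _ _ (hab.shift (-n))).2
      push_cast at this ih ⊢
      convert this ih using 1
      ring
  have fract_pos : ∀ x : ℝ, (∀ m : ℤ, (x : ℂ) ≠ m) → 0 < Int.fract x := fun x hx =>
    (Int.fract_nonneg x).lt_of_ne' fun e => hx ⌊x⌋ (by
      rw [Int.fract, sub_eq_zero] at e
      exact_mod_cast e)
  -- These shifts bring `b - k` and `(a - l) + (b - k)` to fractional parts minus `1`, hence into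
  -- `(-1, 0)`.
  set k : ℤ := ⌊b⌋ + 1
  set l : ℤ := ⌊a + b⌋ + 1 - k
  have h0 : NonIntegral ((a - l : ℝ) : ℂ) ((b - k : ℝ) : ℂ) := by
    have := ((h.shift (-l)).symm.shift (-k)).symm
    simpa [sub_eq_add_neg] using this
  have hb := fract_pos b h.right
  have hab := fract_pos (a + b) (by simpa using h.add)
  have hb' := Int.fract_lt_one b
  have hab' := Int.fract_lt_one (a + b)
  rw [Int.fract] at hb hab hb' hab'
  have ek : (k : ℝ) = ⌊b⌋ + 1 := by push_cast [k]; ring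
  have el : (l : ℝ) = ⌊a + b⌋ + 1 - (⌊b⌋ + 1) := by push_cast [l, k]; ring
  have h1 := base (a - l) (b - k) (by linarith) (by linarith) (by linarith) (by linarith) h0
  have h2 := symm _ _ (shifts l _ _ h0 h1)
  have h3 := symm _ _ (shifts k _ _ (h0.shift l).symm h2)
  simpa using h3

lemma connected {a b : ℝ} (h : NonIntegral a b) : Connected a b :=
  NonIntegral.induction (fun _ _ hb0 hb1 hab hab' => connected_of_mem_Ioo hb0 hb1 hab hab')
    (fun _ _ => Connected.symm) (fun _ _ => connected_sub_one_iff) h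

/-! ### Continuation to the slit plane. -/

/-- `hyperZero a b` continues analytically to the plane slit along `[1, ∞)`. -/
def HasSlitContinuation (a b : ℂ) : Prop :=
  ∃ G : ℂ → ℂ, DifferentiableOn ℂ G {z | 1 - z ∈ Complex.slitPlane} ∧
    ∀ z, ‖z‖ < 1 → G z = hyperZero a b z

/-- The ladder operators between `a` and `a - 1` have polynomial coefficients, so they can be
applied to the continuation on the whole slit plane. -/
lemma hasSlitContinuation_sub_one_iff (h : NonIntegral a b) :
    HasSlitContinuation (a - 1) b ↔ HasSlitContinuation a b := by
  have ha := h.left_ne_zero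
  have hderiv : ∀ {f G : ℂ → ℂ}, (∀ z, ‖z‖ < 1 → G z = f z) → ∀ z, ‖z‖ < 1 →
      deriv G z = deriv f z := by
    intro f G hG z hz
    refine EventuallyEq.deriv_eq ?_
    filter_upwards [(isOpen_lt continuous_norm continuous_const).mem_nhds hz] with w hw
      using hG w hw
  constructor
  · rintro ⟨G, hd, hG⟩
    refine ⟨fun z => (z * (1 - z) * deriv G z + (a + b * z) * G z) / a, ?_, fun z hz => ?_⟩
    · have := hd.deriv isOpen_one_sub_slitPlane
      fun_prop
    · beta_reduce
      rw [hderiv hG z hz, hG z hz, hyperZero_raise h hz]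
      field_simp
  · rintro ⟨G, hd, hG⟩
    refine ⟨fun z => G z - z * deriv G z / a, ?_, fun z hz => ?_⟩
    · have := hd.deriv isOpen_one_sub_slitPlane
      fun_prop
    · beta_reduce
      rw [hderiv hG z hz, hG z hz, hyperZero_lower h hz]
      field_simp
      ring

lemma hasSlitContinuation {a b : ℝ} (h : NonIntegral a b) : HasSlitContinuation a b := by
  refine NonIntegral.induction ?_ (fun a b h => ?_) (fun _ _ => hasSlitContinuation_sub_one_iff) h
  · intro a b hb0 hb1 _ _ h
    refine ⟨fun z => ((Real.Gamma (-b) * Real.Gamma (1 + b) : ℝ) : ℂ)⁻¹ *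
      eulerIntegral (-b) (1 + b) a z, fun z hz => ?_, fun z hz => ?_⟩
    · exact ((eulerIntegral_differentiableAt (by linarith) (by linarith) a hz).const_mul
        _).differentiableWithinAt
    · beta_reduce
      rw [eulerIntegral_eq hb0 hb1 h hz]
      refine inv_mul_cancel_left₀ ?_ _
      exact_mod_cast (mul_pos (Real.Gamma_pos_of_pos (by linarith))
        (Real.Gamma_pos_of_pos (by linarith))).ne'
  · obtain ⟨G, hd, hG⟩ := h
    exact ⟨G, hd, fun z hz => by rw [hG z hz, hyperZero_symm]⟩

/-! ### Truncation, matching of coefficients, and the singular expansion. -/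

lemma exists_norm_ordinaryHypergeometric_sub_sum_le {α β γ : ℂ} (hα : ∀ n : ℕ, α + n ≠ 0) (hβ : ∀ n : ℕ, β + n ≠ 0)
    (hγ : ∀ n : ℕ, γ + n ≠ 0) (N : ℕ) :
    ∃ C : ℝ, 0 ≤ C ∧ ∀ w : ℂ, ‖w‖ < 1 / 2 → ‖ordinaryHypergeometric α β γ w -
      ∑ k ∈ Finset.range N, hypergeometricCoeff α β γ k * w ^ k‖ ≤ C * ‖w‖ ^ N := by
  obtain ⟨r, hr, C, hC, h⟩ := (ordinaryHypergeometric_hasFPowerSeriesOnBall hα hβ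
    hγ).uniform_geometric_approx' (r' := 1 / 2) (by
      rw [ENNReal.coe_div (by norm_num)]; exact ENNReal.half_lt_self one_ne_zero ENNReal.one_ne_top)
  -- The geometric bound is in terms of `‖w‖ / (1 / 2)`, whence the factor `2`.
  refine ⟨C * (r * 2) ^ N, by have := hr.1; positivity, fun w hw => ?_⟩
  have := h w (by simpa using hw) N
  rw [zero_add, FormalMultilinearSeries.partialSum] at this
  simp only [ordinaryHypergeometricSeries, FormalMultilinearSeries.ofScalars_apply_eq,
    smul_eq_mul] at this
  refine this.trans_eq ?_
  push_cast
  rw [mul_assoc, ← mul_pow]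
  congr 2
  ring

lemma ofReal_rising (x : ℝ) (k : ℕ) : ((rising x k : ℝ) : ℂ) = (ascPochhammer ℂ k).eval (x : ℂ) := by
  induction k with
  | zero => simp [rising]
  | succ k ih =>
    rw [rising, Finset.prod_range_succ, Complex.ofReal_mul, ascPochhammer_succ_eval, ← ih, rising]
    push_cast
    rfl

lemma ofReal_lambdaCoeff_div (a b : ℝ) (k : ℕ) :
    ((lambdaCoeff a b k / (k.factorial : ℝ) : ℝ) : ℂ) =
      connOne a b * hypergeometricCoeff (-a) (-b) (-a - b) k := by
  rw [lambdaCoeff, connOne, hypergeometricCoeff, ordinaryHypergeometricCoefficient]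
  push_cast [ofReal_rising, ← Complex.Gamma_ofReal]
  ring

lemma ofReal_muCoeff_div (a b : ℝ) (k : ℕ) :
    ((muCoeff a b k / (k.factorial : ℝ) : ℝ) : ℂ) =
      connPow a b * hypergeometricCoeff (1 + a) (1 + b) (2 + a + b) k := by
  rw [muCoeff, connPow, hypergeometricCoeff, ordinaryHypergeometricCoefficient]
  push_cast [ofReal_rising, ← Complex.Gamma_ofReal]
  ring

/-- Uniqueness of power series identifies the iterated derivatives with the binomial coefficients.
-/
lemma taylorCoeffZero_oneSubPow (a : ℝ) (n : ℕ) :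
    taylorCoeffZero (oneSubPow a) n = hypergeometricCoeff (-a) 1 1 n := by
  have h : HasFPowerSeriesAt (oneSubPow a)
      (FormalMultilinearSeries.ofScalars ℂ (hypergeometricCoeff (-a) 1 1)) 0 := by
    rw [hasFPowerSeriesAt_iff]
    filter_upwards [(isOpen_lt continuous_norm continuous_const).mem_nhds
      (show ‖(0 : ℂ)‖ < 1 by simp)] with z hz
    rw [zero_add]
    refine (hasSum_congr_fun fun n => ?_).1 (hasSum_one_sub_cpow a hz)
    rw [FormalMultilinearSeries.coeff_ofScalars, smul_eq_mul, mul_comm]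
  have e := congrArg (fun p => FormalMultilinearSeries.coeff p n)
    (h.eq_formalMultilinearSeries h.analyticAt.hasFPowerSeriesAt)
  simpa [FormalMultilinearSeries.coeff_ofScalars, taylorCoeffZero] using e.symm

lemma taylorCoeffZero_mul (a b : ℝ) (n : ℕ) :
    taylorCoeffZero (oneSubPow a) n * taylorCoeffZero (oneSubPow b) n =
      hypergeometricCoeff (-a) (-b) 1 n := by
  have h3 : (n.factorial : ℂ) ≠ 0 := by exact_mod_cast n.factorial_ne_zero
  rw [taylorCoeffZero_oneSubPow, taylorCoeffZero_oneSubPow]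
  simp only [hypergeometricCoeff, ordinaryHypergeometricCoefficient, ascPochhammer_eval_one]
  field_simp

/-- The connection formula continues to the unit disc about `1` slit along `[1, 2)`. -/
lemma eq_connection_of_mem_slitPlane {a b : ℝ} (h : NonIntegral a b) {G : ℂ → ℂ}
    (hd : DifferentiableOn ℂ G {z | 1 - z ∈ Complex.slitPlane})
    (hG : ∀ z, ‖z‖ < 1 → G z = hyperZero a b z) {z : ℂ} (hz : 1 - z ∈ Complex.slitPlane)
    (hz1 : ‖1 - z‖ < 1) :
    G z = connOne a b * hyperOne a b (1 - z) +
      connPow a b * ((1 - z) ^ (1 + (a : ℂ) + b) * hyperPow a b (1 - z)) := by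
  -- In the variable `w = 1 - z` the domain is star-shaped about `1 / 2`, hence connected; both
  -- sides agree near `1 / 2` by the formula on the lens.
  set V : Set ℂ := Complex.slitPlane ∩ Metric.ball 0 1 with hV
  have hVo : IsOpen V := Complex.isOpen_slitPlane.inter Metric.isOpen_ball
  have hhalf : ((1 / 2 : ℝ) : ℂ) ∈ Metric.ball (0 : ℂ) 1 := by
    rw [mem_ball_zero_iff, Complex.norm_real]
    norm_num
  have hVc : IsPreconnected V :=
    (((Complex.starConvex_ofReal_slitPlane (x := 1 / 2) (by norm_num)).inter
      ((convex_ball (0 : ℂ) 1).starConvex hhalf)).isPathConnected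
        ⟨Complex.ofReal_mem_slitPlane.2 (by norm_num), hhalf⟩).isConnected.isPreconnected
  have h1 : DifferentiableOn ℂ (fun w => G (1 - w)) V := by
    refine hd.comp (by fun_prop) fun w hw => ?_
    simpa using hw.1
  have h2 : DifferentiableOn ℂ (fun w => connOne a b * hyperOne a b w +
      connPow a b * (w ^ (1 + (a : ℂ) + b) * hyperPow a b w)) V := by
    intro w hw
    have hw1 : ‖w‖ < 1 := by simpa using hw.2
    have := hyperOne_differentiableAt h hw1
    have := hyperPow_differentiableAt h hw1
    have hp : DifferentiableAt ℂ (fun w : ℂ => w ^ (1 + (a : ℂ) + b)) w :=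
      differentiableAt_id.cpow_const hw.1
    exact DifferentiableAt.differentiableWithinAt (by fun_prop)
  have key := (h1.analyticOnNhd hVo).eqOn_of_preconnected_of_eventuallyEq (h2.analyticOnNhd hVo)
    hVc (z₀ := ((1 / 2 : ℝ) : ℂ)) ⟨Complex.ofReal_mem_slitPlane.2 (by norm_num), hhalf⟩ ?_
  · simpa using key (show 1 - z ∈ V from ⟨hz, by simpa using hz1⟩)
  · have hm : (1 - ((1 / 2 : ℝ) : ℂ)) ∈ lens := by
      have := ofReal_mem_lens (x := 1 / 2) (by norm_num)
      convert this using 1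
      push_cast
      norm_num
    have hmem : ∀ᶠ w in nhds ((1 / 2 : ℝ) : ℂ), 1 - w ∈ lens :=
      (isOpen_lens.preimage (continuous_const.sub continuous_id)).mem_nhds hm
    filter_upwards [hmem] with w hw
    have := connected h _ hw
    rw [sub_sub_cancel] at this
    rw [hG _ hw.1, this]

/-- Off the slit plane `z - 1` is a nonnegative real, of argument `0`; the point `z = 1` is covered
by the convention `Complex.arg 0 = 0`. -/
lemma one_sub_mem_slitPlane_of_arg_ne_zero {z : ℂ} (hz : Complex.arg (z - 1) ≠ 0) :
    1 - z ∈ Complex.slitPlane := by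
  by_contra hc
  rw [Complex.mem_slitPlane_iff, not_or, not_lt, not_not] at hc
  apply hz
  rw [Complex.arg_eq_zero_iff]
  simp only [Complex.sub_re, Complex.sub_im, Complex.one_re, Complex.one_im] at hc ⊢
  exact ⟨by linarith [hc.1], by linarith [hc.2]⟩

/-- A compact part of the slit plane containing the points of a `Δ`-domain away from `1`. -/
lemma exists_isCompact_deltaDomain {φ : ℝ} (h0 : 0 < φ) (h1 : φ < Real.pi) (η : ℝ) {ρ : ℝ}
    (hρ : 0 < ρ) :
    ∃ K : Set ℂ, IsCompact K ∧ K ⊆ {z | 1 - z ∈ Complex.slitPlane} ∧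
      ∀ z ∈ deltaDomain φ η, ρ ≤ ‖1 - z‖ → z ∈ K := by
  -- The inequality on the real part says `|arg (z - 1)| ≥ φ` in a form continuous in `z`, so it is
  -- visibly closed.
  refine ⟨Metric.closedBall 0 (1 + η) ∩
    {z | (z - 1).re ≤ ‖z - 1‖ * Real.cos φ ∧ ρ ≤ ‖1 - z‖}, ?_, ?_, ?_⟩
  · refine (isCompact_closedBall _ _).inter_right (IsClosed.inter ?_ ?_)
    · exact isClosed_le (Complex.continuous_re.comp (continuous_id.sub continuous_const))
        ((continuous_id.sub continuous_const).norm.mul continuous_const)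
    · exact isClosed_le continuous_const (continuous_const.sub continuous_id).norm
  · rintro z ⟨-, hz, hzρ⟩
    apply one_sub_mem_slitPlane_of_arg_ne_zero
    intro harg
    have hcos : Real.cos φ < 1 := by
      rw [← Real.cos_zero]
      exact Real.cos_lt_cos_of_nonneg_of_le_pi le_rfl h1.le h0
    have e := Complex.norm_mul_cos_arg (z - 1)
    rw [harg, Real.cos_zero, mul_one] at e
    rw [norm_sub_rev] at hzρ
    rw [← e] at hz
    nlinarith
  · rintro z ⟨hz1, hz2⟩ hzρ
    refine ⟨by simpa using hz1.le, ?_, hzρ⟩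
    have e := Complex.norm_mul_cos_arg (z - 1)
    rw [← e, ← Real.cos_abs]
    exact mul_le_mul_of_nonneg_left
      (Real.cos_le_cos_of_nonneg_of_le_pi h0.le (Complex.abs_arg_le_pi _) hz2.le) (norm_nonneg _)

lemma hasSingularExpansionOn {a b : ℝ} (h : NonIntegral a b) {G : ℂ → ℂ}
    (hd : DifferentiableOn ℂ G {z | 1 - z ∈ Complex.slitPlane})
    (hG : ∀ z, ‖z‖ < 1 → G z = hyperZero a b z) {φ : ℝ} (h0 : 0 < φ) (h1 : φ < Real.pi) (η A : ℝ) :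
    ∃ s : Finset (ℕ ⊕ ℕ),
      (∀ i, i ∈ s ↔ Sum.elim (fun k : ℕ => (k : ℝ)) (fun k : ℕ => a + b + 1 + (k : ℝ)) i < A) ∧
      HasSingularExpansionOn G φ η s
        (Sum.elim (fun k : ℕ => ((lambdaCoeff a b k / (k.factorial : ℝ) : ℝ) : ℂ))
          (fun k : ℕ => ((muCoeff a b k / (k.factorial : ℝ) : ℝ) : ℂ)))
        (Sum.elim (fun k : ℕ => (k : ℝ)) (fun k : ℕ => a + b + 1 + (k : ℝ))) A := by
  -- These ceilings select exactly the exponents below `A` (none when the argument is nonpositive),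
  -- and `A ≤ M`, `A ≤ a + b + 1 + N` make both remainders `O(‖1 - z‖ ^ A)`.
  set M := ⌈A⌉₊ with hM
  set N := ⌈A - (a + b + 1)⌉₊ with hN
  have hs : ∀ i, i ∈ (Finset.range M).disjSum (Finset.range N) ↔
      Sum.elim (fun k : ℕ => (k : ℝ)) (fun k : ℕ => a + b + 1 + (k : ℝ)) i < A := by
    rintro (k | k)
    · simp [hM, Nat.lt_ceil]
    · simp [hN, Nat.lt_ceil, lt_sub_iff_add_lt']
  refine ⟨_, hs, fun i hi => (hs i).1 hi, ?_⟩
  have hslit : ∀ z ∈ deltaDomain φ η, 1 - z ∈ Complex.slitPlane := fun z hz =>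
    one_sub_mem_slitPlane_of_arg_ne_zero fun e => by
      have := hz.2
      rw [e, abs_zero] at this
      exact lt_asymm this h0
  set S : ℂ → ℂ := fun z => ∑ i ∈ (Finset.range M).disjSum (Finset.range N),
    Sum.elim (fun k : ℕ => ((lambdaCoeff a b k / (k.factorial : ℝ) : ℝ) : ℂ))
      (fun k : ℕ => ((muCoeff a b k / (k.factorial : ℝ) : ℝ) : ℂ)) i *
    (1 - z) ^ ((Sum.elim (fun k : ℕ => (k : ℝ)) (fun k : ℕ => a + b + 1 + (k : ℝ)) i : ℝ) : ℂ)
    with hS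
  have hS' : ∀ z, 1 - z ∈ Complex.slitPlane → S z =
      connOne a b * ∑ k ∈ Finset.range M, hypergeometricCoeff (-a) (-b) (-a - b) k * (1 - z) ^ k +
      connPow a b * ((1 - z) ^ (1 + (a : ℂ) + b) *
        ∑ k ∈ Finset.range N, hypergeometricCoeff (1 + a) (1 + b) (2 + a + b) k * (1 - z) ^ k) := by
    intro z hz
    have hz0 := Complex.slitPlane_ne_zero hz
    simp only [hS, Finset.sum_disjSum, Sum.elim_inl, Sum.elim_inr, ofReal_lambdaCoeff_div,
      ofReal_muCoeff_div, Finset.mul_sum]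
    congr 1
    · refine Finset.sum_congr rfl fun k _ => ?_
      rw [Complex.ofReal_natCast, Complex.cpow_natCast, mul_assoc]
    · refine Finset.sum_congr rfl fun k _ => ?_
      push_cast
      rw [show (a : ℂ) + b + 1 + k = 1 + a + b + k by ring, Complex.cpow_add _ _ hz0,
        Complex.cpow_natCast]
      ring
  obtain ⟨C₁, hC₁, H₁⟩ := exists_norm_ordinaryHypergeometric_sub_sum_le h.neg_left h.symm.neg_left h.neg_add M
  obtain ⟨C₂, hC₂, H₂⟩ := exists_norm_ordinaryHypergeometric_sub_sum_le h.one_add_left h.symm.one_add_left h.two_add_add N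
  obtain ⟨K, hK, hKs, hKΔ⟩ := exists_isCompact_deltaDomain h0 h1 η (ρ := 1 / 2) (by norm_num)
  -- Away from `1` no expansion is needed: the error divided by `‖1 - z‖ ^ A` is continuous on a
  -- compact set.
  have hcont : ContinuousOn (fun z => (G z - S z) / ((‖1 - z‖ ^ A : ℝ) : ℂ)) K := by
    have hSc : ContinuousOn S K := by
      refine continuousOn_finsetSum _ fun i _ => continuousOn_const.mul ?_
      exact ContinuousOn.cpow_const (by fun_prop) fun z hz => hKs hz
    have hne : ∀ z ∈ K, ‖1 - z‖ ≠ 0 := fun z hz =>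
      norm_ne_zero_iff.2 (Complex.slitPlane_ne_zero (hKs hz))
    refine ((hd.continuousOn.mono hKs).sub hSc).div (Complex.continuous_ofReal.comp_continuousOn
      (ContinuousOn.rpow_const (by fun_prop) fun z hz => Or.inl (hne z hz))) fun z hz => ?_
    exact_mod_cast (Real.rpow_pos_of_pos ((norm_nonneg _).lt_of_ne' (hne z hz)) A).ne'
  obtain ⟨C₃, H₃⟩ := hK.exists_bound_of_continuousOn hcont
  have hrpow : ∀ {w : ℂ} {n : ℕ} {B : ℝ}, w ≠ 0 → ‖w‖ ≤ 1 → B ≤ n → ‖w‖ ^ n ≤ ‖w‖ ^ B := by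
    intro w n B hw hw1 hB
    rw [← Real.rpow_natCast]
    exact Real.rpow_le_rpow_of_exponent_ge (norm_pos_iff.2 hw) hw1 hB
  rw [isBigO_principal]
  -- The absolute value matters because `C₃` may be negative if `K` is empty.
  refine ⟨‖connOne a b‖ * C₁ + ‖connPow a b‖ * C₂ + |C₃|, fun z hz => ?_⟩
  have hzs := hslit z hz
  have hw0 := Complex.slitPlane_ne_zero hzs
  have hwp := norm_pos_iff.2 hw0
  have hA : 0 < ‖1 - z‖ ^ A := Real.rpow_pos_of_pos hwp A
  rw [Real.norm_of_nonneg hA.le]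
  change ‖G z - S z‖ ≤ _
  rcases lt_or_ge ‖1 - z‖ (1 / 2) with hlt | hge
  · have hlt1 : ‖1 - z‖ ≤ 1 := by linarith
    have e : G z - S z = connOne a b * (hyperOne a b (1 - z) -
        ∑ k ∈ Finset.range M, hypergeometricCoeff (-a) (-b) (-a - b) k * (1 - z) ^ k) +
        connPow a b * ((1 - z) ^ (1 + (a : ℂ) + b) * (hyperPow a b (1 - z) -
        ∑ k ∈ Finset.range N, hypergeometricCoeff (1 + a) (1 + b) (2 + a + b) k * (1 - z) ^ k)) := by
      rw [hS' z hzs, eq_connection_of_mem_slitPlane h hd hG hzs (by linarith)]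
      ring
    have hpow : ‖(1 - z) ^ (1 + (a : ℂ) + b)‖ = ‖1 - z‖ ^ (a + b + 1) := by
      rw [show 1 + (a : ℂ) + b = ((a + b + 1 : ℝ) : ℂ) by push_cast; ring,
        Complex.norm_cpow_real]
    have b1 : ‖hyperOne a b (1 - z) - ∑ k ∈ Finset.range M,
        hypergeometricCoeff (-a) (-b) (-a - b) k * (1 - z) ^ k‖ ≤ C₁ * ‖1 - z‖ ^ A :=
      (H₁ _ hlt).trans (mul_le_mul_of_nonneg_left (hrpow hw0 hlt1 (Nat.le_ceil A)) hC₁)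
    have b2 : ‖1 - z‖ ^ (a + b + 1) * ‖hyperPow a b (1 - z) - ∑ k ∈ Finset.range N,
        hypergeometricCoeff (1 + a) (1 + b) (2 + a + b) k * (1 - z) ^ k‖ ≤ C₂ * ‖1 - z‖ ^ A := by
      have b3 := (H₂ _ hlt).trans (mul_le_mul_of_nonneg_left
        (hrpow hw0 hlt1 (Nat.le_ceil (A - (a + b + 1)))) hC₂)
      refine (mul_le_mul_of_nonneg_left b3 (Real.rpow_nonneg hwp.le _)).trans_eq ?_
      rw [mul_left_comm, ← Real.rpow_add hwp, add_sub_cancel]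
    rw [e]
    refine (norm_add_le _ _).trans ?_
    rw [norm_mul, norm_mul, norm_mul, hpow]
    calc _ ≤ ‖connOne a b‖ * (C₁ * ‖1 - z‖ ^ A) + ‖connPow a b‖ * (C₂ * ‖1 - z‖ ^ A) := by gcongr
      _ ≤ ‖connOne a b‖ * (C₁ * ‖1 - z‖ ^ A) + ‖connPow a b‖ * (C₂ * ‖1 - z‖ ^ A) +
          |C₃| * ‖1 - z‖ ^ A := le_add_of_nonneg_right (by positivity)
      _ = _ := by ring
  · have b3 := H₃ z (hKΔ z hz hge)
    rw [norm_div, Complex.norm_real, Real.norm_of_nonneg hA.le, div_le_iff₀ hA] at b3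
    refine b3.trans (mul_le_mul_of_nonneg_right ?_ hA.le)
    have := le_abs_self C₃
    have : 0 ≤ ‖connOne a b‖ * C₁ + ‖connPow a b‖ * C₂ := by positivity
    linarith

end HypergeometricConnection

theorem mainTheorem4 (a b : ℝ) (ha : ∀ m : ℤ, a ≠ m) (hb : ∀ m : ℤ, b ≠ m)
    (hab : ∀ m : ℤ, a + b ≠ m) :
    (∀ z : ℂ, ‖z‖ < 1 →
      HasSum
        (fun n : ℕ => taylorCoeffZero (oneSubPow a) n * taylorCoeffZero (oneSubPow b) n * z ^ n)
        (ordinaryHypergeometric (-a : ℂ) (-b : ℂ) (1 : ℂ) z) ∧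
      hadamardProduct (oneSubPow a) (oneSubPow b) z =
        ordinaryHypergeometric (-a : ℂ) (-b : ℂ) (1 : ℂ) z) ∧
    IsDeltaRegular (hadamardProduct (oneSubPow a) (oneSubPow b)) ∧
    HasInfiniteDeltaExpansion (ι := ℕ ⊕ ℕ)
      (hadamardProduct (oneSubPow a) (oneSubPow b))
      (Sum.elim (fun k : ℕ => ((lambdaCoeff a b k / (k.factorial : ℝ) : ℝ) : ℂ))
        (fun k : ℕ => ((muCoeff a b k / (k.factorial : ℝ) : ℝ) : ℂ)))
      (Sum.elim (fun k : ℕ => (k : ℝ)) (fun k : ℕ => a + b + 1 + (k : ℝ))) := by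
  have h : NonIntegral (a : ℂ) b :=
    ⟨fun m hm => ha m (by exact_mod_cast hm), fun m hm => hb m (by exact_mod_cast hm),
      fun m hm => hab m (by exact_mod_cast hm)⟩
  have hsum : ∀ z : ℂ, ‖z‖ < 1 → HasSum
      (fun n : ℕ => taylorCoeffZero (oneSubPow a) n * taylorCoeffZero (oneSubPow b) n * z ^ n)
      (ordinaryHypergeometric (-a : ℂ) (-b : ℂ) (1 : ℂ) z) := fun z hz => by
    simp only [taylorCoeffZero_mul]
    exact ordinaryHypergeometric_hasSum h.neg_left h.symm.neg_left one_add_natCast_ne_zero hz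
  have hprod : ∀ z : ℂ, ‖z‖ < 1 → hadamardProduct (oneSubPow a) (oneSubPow b) z =
      ordinaryHypergeometric (-a : ℂ) (-b : ℂ) (1 : ℂ) z := fun z hz => (hsum z hz).tsum_eq
  have htaylor : IsTaylorOfRadiusOne (hadamardProduct (oneSubPow a) (oneSubPow b)) := by
    refine ⟨_, ordinaryHypergeometric_radius h.neg_left h.symm.neg_left one_add_natCast_ne_zero,
      (ordinaryHypergeometric_hasFPowerSeriesOnBall h.neg_left h.symm.neg_left
        one_add_natCast_ne_zero).congr fun z hz => (hprod z ?_).symm⟩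
    rw [← ENNReal.ofReal_one, Metric.eball_ofReal] at hz
    simpa using hz
  obtain ⟨G, hd, hG⟩ := hasSlitContinuation h
  -- The slit plane contains `Δ(φ, η)` for all positive `φ` and `η`, so the values `π / 4` and `1`
  -- are arbitrary choices.
  have hcont : ∀ η, IsDeltaContinuation (hadamardProduct (oneSubPow a) (oneSubPow b))
      (Real.pi / 4) η G := fun η => by
    refine ⟨hd.mono fun z hz => one_sub_mem_slitPlane_of_arg_ne_zero fun e => ?_, fun z hz => ?_⟩
    · have := hz.2
      rw [e, abs_zero] at this
      linarith [Real.pi_pos]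
    · have hz' : ‖z‖ < 1 := by simpa using hz
      rw [hG z hz', hprod z hz', hyperZero]
  have hpi := Real.pi_pos
  refine ⟨fun z hz => ⟨hsum z hz, hprod z hz⟩, ⟨htaylor, Real.pi / 4, 1, by linarith, by linarith,
    one_pos, G, hcont 1⟩, htaylor, inferInstance, ?_, Real.pi / 4, 1, by linarith, by linarith,
    one_pos, G, hcont 1, fun A => hasSingularExpansionOn h hd hG (by linarith) (by linarith) 1 A⟩
  -- An exponent common to both families would make `a + b` an integer.
  rintro (i | i) (j | j) hij
  · simpa using hij
  · exact absurd (show a + b = ((i - 1 - j : ℤ) : ℝ) by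
      push_cast; simp only [Sum.elim_inl, Sum.elim_inr] at hij; linarith) (hab _)
  · exact absurd (show a + b = ((j - 1 - i : ℤ) : ℝ) by
      push_cast; simp only [Sum.elim_inl, Sum.elim_inr] at hij; linarith) (hab _)
  · simpa using hij
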